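/- **Theorem.** Let $n,m\ge 0$, $A,B_w\in\mathbb{R}^{n\times n}$, $B\in\mathbb{R}^{n\times m}$, let $Q_2,Q_\infty\in\mathbb{R}^{n\times n}$ and $R_2,R_\infty\in\mathbb{R}^{m\times m}$ be symmetric with $Q_2\succeq0$, $R_2\succ0$, $Q_\infty\succeq0$, $R_\infty\succeq0$, and assume that $(A,B)$ is stabilizable and $(Q_2^{1/2},A)$ is detectable. Put $W=B_wB_w^{\mathsf T}$ and, for $K\in\mathbb{R}^{m\times n}$, put $A_K=A+BK$, $S_K=Q_\infty+K^{\mathsf T}R_\infty K$ and $$\mathbf{T}_\infty(K)(s)=\begin{bmatrix}Q_\infty^{1/2}\\ R_\infty^{1/2}K\end{bmatrix}(sI-A_K)^{-1}B_w .$$ For $\beta>0$ let $\mathcal{K}_\beta$ be the set of all $K$ such that $A_K$ is Hurwitz and $\|\mathbf{T}_\infty(K)\|_{\mathcal{H}_\infty}<\beta$. A *stabilizing solution* at $K$ is a symmetric $X$ with $$A_KX+XA_K^{\mathsf T}+\beta^{-2}XS_KX+W=0\quad\text{and}\quad \tilde A_K:=A_K+\beta^{-2}XS_K\ \text{Hurwitz};$$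 it is unique when it exists, and is then denoted $X_K$. The two-channel mixed problem is $\inf_{K\in\mathcal{K}_\beta}J_{\mathrm{mix}}(K)$ with $J_{\mathrm{mix}}(K)=\operatorname{tr}\big((Q_2+K^{\mathsf T}R_2K)X_K\big)$. Then there is a threshold $\bar\beta>0$, depending only on the data $A,B,B_w,Q_2,R_2,Q_\infty,R_\infty$, such that for every $\beta>\bar\beta$ the problem has a stationary point $K\in\mathcal{K}_\beta$, that is, $J_{\mathrm{mix}}$ is differentiable at $K$ and $\nabla J_{\mathrm{mix}}(K)=0$. Equivalently, the coupled optimality system has a solution: for the same $K$ there are matrices $X\succeq0$ and $\Gamma\succeq0$ such that $X$ is the stabilizing solution at $K$ and $$R_2K+B^{\mathsf T}\Gamma+\beta^{-2}R_\infty KX\Gamma=0,\qquad \tilde A_K^{\mathsf T}\Gamma+\Gamma\tilde A_K+Q_2+K^{\mathsf T}R_2K=0 .$$ Moreover $X\succ0$ if $W\succ0$; and whenever $R_\infty=\alpha^2R_2$ with $\alpha\ge0$, the matrix $I+\beta^{-2}\alpha^2X\Gamma$ is invertible and the first equation takes the form $K=-R_2^{-1}B^{\mathsf T}\Gamma\,(I+\beta^{-2}\alpha^2X\Gamma)^{-1}$.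 -/

import Mathlib

open scoped Matrix

noncomputable section

namespace MixedControl

open scoped MatrixOrder

/-- A real square matrix is Hurwitz if every complex eigenvalue has negative real part. -/
def IsHurwitz {n : ℕ} (A : Matrix (Fin n) (Fin n) ℝ) : Prop :=
  ∀ z ∈ spectrum ℂ (A.map (algebraMap ℝ ℂ)), z.re < 0

/-- `(A, B)` is stabilizable: some static state feedback renders `A + B K` Hurwitz. -/
def IsStabilizable {n m : ℕ} (A : Matrix (Fin n) (Fin n) ℝ) (B : Matrix (Fin n) (Fin m) ℝ) :
    Prop :=
  ∃ K : Matrix (Fin m) (Fin n) ℝ, IsHurwitz (A + B * K)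

/-- `(C, A)` is detectable: some output injection renders `A + L C` Hurwitz. -/
def IsDetectable {n p : ℕ} (C : Matrix (Fin p) (Fin n) ℝ) (A : Matrix (Fin n) (Fin n) ℝ) :
    Prop :=
  ∃ L : Matrix (Fin n) (Fin p) ℝ, IsHurwitz (A + L * C)

/-- The positive semidefinite square root `Q^{1/2}` of a positive semidefinite matrix `Q`. -/
def psdSqrt {k : ℕ} (Q : Matrix (Fin k) (Fin k) ℝ) : Matrix (Fin k) (Fin k) ℝ :=
  CFC.sqrt Q

/-- The data of the two-channel problem: the dynamics `x' = A x + B u + B_w w` (`A`, `B`, `Bw`)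
and the weights of the performance outputs `z₂` (`Q₂`, `R₂`) and `z_∞` (`Qi`, `Ri`). -/
structure Data (n m : ℕ) where
  A : Matrix (Fin n) (Fin n) ℝ
  B : Matrix (Fin n) (Fin m) ℝ
  Bw : Matrix (Fin n) (Fin n) ℝ
  Q₂ : Matrix (Fin n) (Fin n) ℝ
  R₂ : Matrix (Fin m) (Fin m) ℝ
  Qi : Matrix (Fin n) (Fin n) ℝ
  Ri : Matrix (Fin m) (Fin m) ℝ

namespace Data

variable {n m : ℕ} (P : Data n m)

/-- The disturbance weight `W = B_w B_wᵀ`. -/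
def W : Matrix (Fin n) (Fin n) ℝ := P.Bw * P.Bwᵀ

/-- The closed-loop matrix `A_K = A + B K`. -/
def AK (K : Matrix (Fin m) (Fin n) ℝ) : Matrix (Fin n) (Fin n) ℝ := P.A + P.B * K

/-- `S_K = Q_∞ + Kᵀ R_∞ K`. -/
def SK (K : Matrix (Fin m) (Fin n) ℝ) : Matrix (Fin n) (Fin n) ℝ := P.Qi + Kᵀ * P.Ri * K

/-- The transfer function from `w` to `z_∞`,
`T_∞(K)(s) = [Q_∞^{1/2} ; R_∞^{1/2} K] (s I - A_K)⁻¹ B_w`. -/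
def Tinf (K : Matrix (Fin m) (Fin n) ℝ) (s : ℂ) : Matrix (Fin n ⊕ Fin m) (Fin n) ℂ :=
  (Matrix.fromRows (psdSqrt P.Qi) (psdSqrt P.Ri * K)).map (algebraMap ℝ ℂ) *
    (Matrix.scalar (Fin n) s - (P.AK K).map (algebraMap ℝ ℂ))⁻¹ *
    P.Bw.map (algebraMap ℝ ℂ)

open scoped Matrix.Norms.L2Operator in
/-- The `H_∞` norm of `T_∞(K)` (for stabilizing `K`): the supremum over the open right half-plane
of the largest singular value. -/
def hinfNorm (K : Matrix (Fin m) (Fin n) ℝ) : ENNReal :=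
  ⨆ s ∈ {s : ℂ | 0 < s.re}, ENNReal.ofReal ‖P.Tinf K s‖

/-- The feasible set `𝒦_β`: stabilizing policies with `‖T_∞(K)‖_{H_∞} < β`. -/
def feasibleSet (β : ℝ) : Set (Matrix (Fin m) (Fin n) ℝ) :=
  {K | IsHurwitz (P.AK K) ∧ P.hinfNorm K < ENNReal.ofReal β}

/-- `Ã_K = A_K + β⁻² X S_K`. -/
def AKtilde (β : ℝ) (K : Matrix (Fin m) (Fin n) ℝ) (X : Matrix (Fin n) (Fin n) ℝ) :
    Matrix (Fin n) (Fin n) ℝ :=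
  P.AK K + (β ^ 2)⁻¹ • (X * P.SK K)

/-- `X` is a (symmetric) stabilizing solution to the Riccati equation
`A_K X + X A_Kᵀ + β⁻² X S_K X + W = 0`, i.e. `A_K + β⁻² X S_K` is Hurwitz. -/
structure IsStabilizingSolution (β : ℝ) (K : Matrix (Fin m) (Fin n) ℝ)
    (X : Matrix (Fin n) (Fin n) ℝ) : Prop where
  isSymm : X.IsSymm
  riccati : P.AK K * X + X * (P.AK K)ᵀ + (β ^ 2)⁻¹ • (X * P.SK K * X) + P.W = 0
  hurwitz : IsHurwitz (P.AKtilde β K X)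

open scoped Classical in
/-- The stabilizing solution `X_K` to the Riccati equation (`0` when there is none). -/
def XK (β : ℝ) (K : Matrix (Fin m) (Fin n) ℝ) : Matrix (Fin n) (Fin n) ℝ :=
  if h : ∃ X, P.IsStabilizingSolution β K X then h.choose else 0

/-- The mixed cost `J_mix(K) = tr((Q₂ + Kᵀ R₂ K) X_K)`. -/
def Jmix (β : ℝ) (K : Matrix (Fin m) (Fin n) ℝ) : ℝ :=
  ((P.Q₂ + Kᵀ * P.R₂ * K) * P.XK β K).trace

/-- `K` is a stationary point of the problem `inf_{K ∈ 𝒦_β} J_mix(K)`: it is feasible, and `J_mix`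
is differentiable at `K` with zero derivative, i.e. `∇ J_mix(K) = 0`. -/
def IsStationaryPoint (β : ℝ) (K : Matrix (Fin m) (Fin n) ℝ) : Prop :=
  K ∈ P.feasibleSet β ∧ HasFDerivAt (P.Jmix β) (0 : Matrix (Fin m) (Fin n) ℝ →L[ℝ] ℝ) K

/-- The coupled optimality system in `(K, X, Γ)`, for general `R_∞`: positive semidefinite `X`, `Γ`
with `X` the stabilizing solution to the Riccati equation. -/
structure SolvesOptimalitySystem (β : ℝ) (K : Matrix (Fin m) (Fin n) ℝ)
    (X Γ : Matrix (Fin n) (Fin n) ℝ) : Prop where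
  gain : P.R₂ * K + P.Bᵀ * Γ + (β ^ 2)⁻¹ • (P.Ri * K * X * Γ) = 0
  stabilizing : P.IsStabilizingSolution β K X
  lyapunov : (P.AKtilde β K X)ᵀ * Γ + Γ * P.AKtilde β K X + P.Q₂ + Kᵀ * P.R₂ * K = 0
  posX : X.PosSemidef
  posΓ : Γ.PosSemidef

end Data

/-- A Sylvester equation `M D + D Nᵀ = 0` with Hurwitz `M`, `N` has only the zero solution. -/
theorem sylvester_eq_zero {n : ℕ} {M N D : Matrix (Fin n) (Fin n) ℝ} (hM : IsHurwitz M)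
    (hN : IsHurwitz N) (h : M * D + D * Nᵀ = 0) : D = 0 := by
  set f : Matrix (Fin n) (Fin n) ℝ →+* Matrix (Fin n) (Fin n) ℂ :=
    (algebraMap ℝ ℂ).mapMatrix with hf
  set M' : Matrix (Fin n) (Fin n) ℂ := f M with hM'
  set N' : Matrix (Fin n) (Fin n) ℂ := f N with hN'
  have hT : f Nᵀ = N'ᵀ := by
    ext i j; simp [hf, hN']
  have h1 : M' * f D = f D * (-N'ᵀ) := by
    have := congrArg f h
    rw [map_add, map_mul, map_mul, map_zero, hT] at this
    rw [mul_neg]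
    exact eq_neg_of_add_eq_zero_left this
  have h2 : ∀ p : Polynomial ℂ,
      Polynomial.aeval M' p * f D = f D * Polynomial.aeval (-N'ᵀ) p := by
    intro p
    induction p using Polynomial.induction_on' with
    | add p q hp hq => simp only [map_add, add_mul, mul_add, hp, hq]
    | monomial k a =>
      have hk : ∀ k : ℕ, M' ^ k * f D = f D * (-N'ᵀ) ^ k := by
        intro k
        induction k with
        | zero => simp
        | succ k ih => rw [pow_succ, mul_assoc, h1, ← mul_assoc, ih, mul_assoc, ← pow_succ]
      rw [Polynomial.aeval_monomial, Polynomial.aeval_monomial, mul_assoc, hk,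
        Algebra.left_comm]
  have h3 := h2 M'.charpoly
  rw [Matrix.aeval_self_charpoly, zero_mul] at h3
  have hu : IsUnit (Polynomial.aeval (-N'ᵀ) M'.charpoly) := by
    by_contra hnu
    rcases isEmpty_or_nonempty (Fin n) with he | he
    · exact hnu (isUnit_of_subsingleton _)
    have h0 : (0 : ℂ) ∈ spectrum ℂ (Polynomial.aeval (-N'ᵀ) M'.charpoly) := by
      rwa [spectrum.zero_mem_iff]
    rw [spectrum.map_polynomial_aeval_of_degree_pos] at h0
    · obtain ⟨z, hz, hz0⟩ := h0
      have hzM : z ∈ spectrum ℂ M' := Matrix.mem_spectrum_iff_isRoot_charpoly.2 hz0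
      have hzN : -z ∈ spectrum ℂ N' := by
        rw [← spectrum.neg_eq, Set.mem_neg] at hz
        have : -z ∈ spectrum ℂ N'ᵀ := hz
        rwa [Matrix.mem_spectrum_iff_isRoot_charpoly, Matrix.charpoly_transpose,
          ← Matrix.mem_spectrum_iff_isRoot_charpoly] at this
      have a := hM z hzM
      have b := hN (-z) hzN
      rw [Complex.neg_re] at b
      linarith
    · rw [Matrix.charpoly_degree_eq_dim]
      exact_mod_cast Fintype.card_pos
  have h4 : f D = 0 := by
    obtain ⟨u, hu⟩ := hu
    rw [← hu] at h3
    have := congrArg (· * (↑u⁻¹ : Matrix (Fin n) (Fin n) ℂ)) h3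
    simpa [mul_assoc] using this.symm
  ext i j
  have := congrFun (congrFun h4 i) j
  simpa [hf] using this

/-- The stabilizing solution is unique, so `XK` does not depend on a choice. -/
theorem Data.IsStabilizingSolution.unique {n m : ℕ} {P : Data n m} {β : ℝ}
    {K : Matrix (Fin m) (Fin n) ℝ} (hR : P.Ri.IsSymm) (hQ : P.Qi.IsSymm)
    {X Y : Matrix (Fin n) (Fin n) ℝ} (hX : P.IsStabilizingSolution β K X)
    (hY : P.IsStabilizingSolution β K Y) : X = Y := by
  have hS : (P.SK K)ᵀ = P.SK K := by
    simp [Data.SK, hR.eq, hQ.eq, Matrix.mul_assoc]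
  refine sub_eq_zero.1 (sylvester_eq_zero hX.hurwitz hY.hurwitz ?_)
  have e1 := hX.riccati
  have e2 := hY.riccati
  have e3 := e1.trans e2.symm
  rw [← sub_eq_zero] at e3
  rw [← e3]
  simp only [Data.AKtilde, Matrix.transpose_add, Matrix.transpose_smul, Matrix.transpose_mul, hS,
    hY.isSymm.eq, add_mul, mul_add, mul_sub, sub_mul, smul_mul_assoc, mul_smul_comm, smul_sub,
    ← mul_assoc]
  abel

end MixedControl

end

/-! Put `e = β⁻²`. The optimality system then depends polynomially on `(e, K, Γ, X)`, and at `e = 0`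
it decouples: `(K, Γ)` solve the LQR problem for the first channel, and `X` solves a Lyapunov
equation. The linearization at this point is injective, so the implicit function theorem continues
the LQR solution to all small `e`, that is, to all large `β` (`exists_solution_near_zero`).

Near the LQR gain, closed loops stay Hurwitz and their `H_∞` norms stay below a fixed `c`
(`eventually_hinfNorm_le`), so `β > c` gives feasibility. Lyapunov's theorem gives the signs of `X`
and `Γ`.

For stationarity, a second use of the implicit function theorem, now with `β` fixed, shows that
`X_K` is differentiable in `K`. The matrix `Γ` is the adjoint variable: pairing it with the
linearized Riccati equation reduces the derivative of the cost to the gain equation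
(`hasFDerivAt_Jmix`).

Every injectivity or uniqueness claim about matrix equations reduces to `sylvester_eq_zero`. -/

namespace MixedControl

open Filter Topology
open scoped ComplexOrder Matrix

/-! ### Hurwitz matrices and Lyapunov's theorem -/

/-- A real matrix is Hurwitz iff it has no complex eigenvector for the closed right half-plane. -/
theorem isHurwitz_iff_eigenvector {n : ℕ} {A : Matrix (Fin n) (Fin n) ℝ} :
    IsHurwitz A ↔ ∀ z : ℂ, 0 ≤ z.re → ∀ v : Fin n → ℂ,
      A.map (algebraMap ℝ ℂ) *ᵥ v = z • v → v = 0 := by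
  have key : ∀ z : ℂ, z ∈ spectrum ℂ (A.map (algebraMap ℝ ℂ)) ↔
      ∃ v : Fin n → ℂ, v ≠ 0 ∧ A.map (algebraMap ℝ ℂ) *ᵥ v = z • v := by
    intro z
    rw [spectrum.mem_iff, Matrix.isUnit_iff_isUnit_det, isUnit_iff_ne_zero, not_not,
      ← Matrix.exists_mulVec_eq_zero_iff]
    refine exists_congr fun v => and_congr_right fun _ => ?_
    rw [Matrix.sub_mulVec, sub_eq_zero, Algebra.algebraMap_eq_smul_one, Matrix.smul_mulVec,
      Matrix.one_mulVec, eq_comm]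
  constructor
  · intro h z hz v hv
    by_contra hv0
    exact (h z ((key z).2 ⟨v, hv0, hv⟩)).not_ge hz
  · intro h z hz
    obtain ⟨v, hv0, hv⟩ := (key z).1 hz
    by_contra hz0
    exact hv0 (h z (not_lt.1 hz0) v hv)

theorem IsHurwitz.transpose {n : ℕ} {A : Matrix (Fin n) (Fin n) ℝ} (h : IsHurwitz A) :
    IsHurwitz Aᵀ := by
  intro z hz
  apply h z
  rw [Matrix.transpose_map] at hz
  rwa [Matrix.mem_spectrum_iff_isRoot_charpoly, Matrix.charpoly_transpose,
    ← Matrix.mem_spectrum_iff_isRoot_charpoly] at hz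

/-- A Lyapunov equation with Hurwitz coefficient is solvable. -/
theorem IsHurwitz.exists_lyapunov {n : ℕ} {A : Matrix (Fin n) (Fin n) ℝ} (h : IsHurwitz A)
    (Q : Matrix (Fin n) (Fin n) ℝ) : ∃ H, Aᵀ * H + H * A + Q = 0 := by
  let L : Matrix (Fin n) (Fin n) ℝ →ₗ[ℝ] Matrix (Fin n) (Fin n) ℝ :=
    LinearMap.mulLeft ℝ Aᵀ + LinearMap.mulRight ℝ A
  have hL : Function.Injective L := by
    rw [injective_iff_map_eq_zero]
    intro D hD
    refine sylvester_eq_zero h.transpose h.transpose ?_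
    rw [Matrix.transpose_transpose]
    exact hD
  obtain ⟨H, hH⟩ := LinearMap.injective_iff_surjective.1 hL (-Q)
  refine ⟨H, ?_⟩
  have : Aᵀ * H + H * A = -Q := hH
  rw [this, neg_add_cancel]

open scoped Matrix.Norms.L2Operator in
/-- Powers of a complex matrix with spectrum in the open unit disc tend to zero. -/
theorem tendsto_pow_of_spectrum_lt_one {n : ℕ} {M : Matrix (Fin n) (Fin n) ℂ}
    (h : ∀ z ∈ spectrum ℂ M, ‖z‖ < 1) : Tendsto (fun k : ℕ => M ^ k) atTop (𝓝 0) := by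
  rcases isEmpty_or_nonempty (Fin n) with he | he
  · exact tendsto_const_nhds.congr fun k => Subsingleton.elim _ _
  have hr : spectralRadius ℂ M < 1 :=
    spectrum.spectralRadius_lt_of_forall_lt M (r := 1) fun z hz => h z hz
  -- By Gelfand's formula, any `r` strictly between the spectral radius and `1` satisfies `‖M ^ k‖ ≤
  -- r ^ k` for large `k`.
  obtain ⟨r, hr1, hr2⟩ := ENNReal.lt_iff_exists_nnreal_btwn.1 hr
  have hg := spectrum.pow_nnnorm_pow_one_div_tendsto_nhds_spectralRadius M
  have he := hg.eventually (gt_mem_nhds hr1)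
  rw [tendsto_zero_iff_norm_tendsto_zero]
  have hr' : (r : ℝ) < 1 := by exact_mod_cast hr2
  refine squeeze_zero' (Eventually.of_forall fun _ => norm_nonneg _) ?_
    (tendsto_pow_atTop_nhds_zero_of_lt_one r.2 hr')
  filter_upwards [he, eventually_gt_atTop 0] with k hk hk0
  have hk' : ((‖M ^ k‖₊ : ENNReal) ^ (1 / k : ℝ)) ^ (k : ℝ) ≤ (r : ENNReal) ^ (k : ℝ) :=
    ENNReal.rpow_le_rpow hk.le (Nat.cast_nonneg k)
  rw [← ENNReal.rpow_mul, one_div_mul_cancel (by positivity), ENNReal.rpow_one,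
    ENNReal.rpow_natCast] at hk'
  have : ‖M ^ k‖₊ ≤ r ^ k := by exact_mod_cast hk'
  exact_mod_cast this

theorem posSemidef_of_forall_dotProduct {n : ℕ} {M : Matrix (Fin n) (Fin n) ℝ} (h : M.IsSymm)
    (h' : ∀ x : Fin n → ℝ, 0 ≤ x ⬝ᵥ (M *ᵥ x)) : M.PosSemidef :=
  Matrix.PosSemidef.of_dotProduct_mulVec_nonneg
    (by rwa [Matrix.IsHermitian, Matrix.conjTranspose_eq_transpose_of_trivial]) (by simpa using h')

/-- A solution of a Stein inequality with power-stable coefficient is positive semidefinite. -/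
theorem posSemidef_of_stein {n : ℕ} {C H : Matrix (Fin n) (Fin n) ℝ}
    (hC : Tendsto (fun k : ℕ => C ^ k) atTop (𝓝 0)) (hH : H.IsSymm)
    (h : (H - Cᵀ * H * C).PosSemidef) : H.PosSemidef := by
  refine posSemidef_of_forall_dotProduct hH fun x => ?_
  -- Conjugating the Stein inequality by `C ^ k` shows that these forms decrease in `k`. Their limit
  -- is `0`, so the form of `H` is nonnegative.
  have hk : ∀ k : ℕ, x ⬝ᵥ (((C ^ k)ᵀ * H * C ^ k) *ᵥ x) ≤ x ⬝ᵥ (H *ᵥ x) := by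
    intro k
    induction k with
    | zero => simp
    | succ k ih =>
      refine le_trans ?_ ih
      have h1 := (h.conjTranspose_mul_mul_same (C ^ k)).dotProduct_mulVec_nonneg x
      rw [Matrix.conjTranspose_eq_transpose_of_trivial, star_trivial, Matrix.mul_sub,
        Matrix.sub_mul, Matrix.sub_mulVec, dotProduct_sub, sub_nonneg] at h1
      have e : (C ^ (k + 1))ᵀ * H * C ^ (k + 1) = (C ^ k)ᵀ * (Cᵀ * H * C) * C ^ k := by
        rw [pow_succ', Matrix.transpose_mul]
        simp only [Matrix.mul_assoc]
      rwa [e]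
  have hlim : Tendsto (fun k : ℕ => x ⬝ᵥ (((C ^ k)ᵀ * H * C ^ k) *ᵥ x)) atTop
      (𝓝 (x ⬝ᵥ (((0 : Matrix (Fin n) (Fin n) ℝ)ᵀ * H * 0) *ᵥ x))) := by
    have hc : Continuous fun D : Matrix (Fin n) (Fin n) ℝ => x ⬝ᵥ ((Dᵀ * H * D) *ᵥ x) := by
      fun_prop
    exact (hc.tendsto 0).comp hC
  simpa using le_of_tendsto' hlim hk

/-- The Cayley transform of a Hurwitz matrix is power stable. -/
theorem IsHurwitz.tendsto_cayley_pow {n : ℕ} {A : Matrix (Fin n) (Fin n) ℝ} (h : IsHurwitz A)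
    {M : Matrix (Fin n) (Fin n) ℝ} (hM : (1 - A) * M = 1) :
    Tendsto (fun k : ℕ => ((1 + A) * M) ^ k) atTop (𝓝 0) := by
  set f : Matrix (Fin n) (Fin n) ℝ →+* Matrix (Fin n) (Fin n) ℂ := (algebraMap ℝ ℂ).mapMatrix
    with hf
  have hC : Tendsto (fun k : ℕ => (f ((1 + A) * M)) ^ k) atTop (𝓝 0) := by
    apply tendsto_pow_of_spectrum_lt_one
    intro z hz
    rw [spectrum.mem_iff, Matrix.isUnit_iff_isUnit_det, isUnit_iff_ne_zero, not_not,
      ← Matrix.exists_mulVec_eq_zero_iff] at hz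
    obtain ⟨v, hv0, hv⟩ := hz
    rw [Matrix.sub_mulVec, sub_eq_zero, Algebra.algebraMap_eq_smul_one, Matrix.smul_mulVec,
      Matrix.one_mulVec] at hv
    -- Undoing the Cayley transform: an eigenvector `v` for `z` gives an eigenvector `w` of `A` for
    -- `(z - 1) / (1 + z)`. The value `z = -1` would give `-2 w = 0`.
    set w := f M *ᵥ v with hw
    have hv1 : v = w - f A *ᵥ w := by
      have := congrArg f hM
      rw [map_mul, map_sub, map_one] at this
      rw [hw]
      nth_rewrite 1 [← Matrix.one_mulVec v, ← this, ← Matrix.mulVec_mulVec]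
      rw [Matrix.sub_mulVec, Matrix.one_mulVec]
    have hv2 : z • v = w + f A *ᵥ w := by
      rw [hv, map_mul, ← Matrix.mulVec_mulVec, map_add, map_one, Matrix.add_mulVec,
        Matrix.one_mulVec]
    have hw0 : w ≠ 0 := by
      intro h0
      apply hv0
      rw [hv1, h0, Matrix.mulVec_zero, sub_zero]
    have hA : (1 + z) • (f A *ᵥ w) = (z - 1) • w := by
      rw [hv1, smul_sub] at hv2
      rw [add_smul, one_smul, sub_smul, one_smul, ← sub_eq_zero]
      rw [← sub_eq_zero] at hv2
      rw [← neg_eq_zero, ← hv2]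
      abel
    have hz1 : 1 + z ≠ 0 := by
      intro h0
      rw [h0, zero_smul] at hA
      have hz : z = -1 := by linear_combination h0
      have := (smul_eq_zero.1 hA.symm).resolve_right hw0
      rw [hz] at this
      norm_num at this
    have hA' : f A *ᵥ w = ((z - 1) / (1 + z)) • w := by
      rw [div_eq_inv_mul, mul_smul, ← hA, smul_smul, inv_mul_cancel₀ hz1, one_smul]
    -- The real part of `(z - 1) / (1 + z)` is `(|z|² - 1) / |1 + z|²`, which is nonnegative if `|z|
    -- ≥ 1`.
    by_contra hz2
    refine hw0 (isHurwitz_iff_eigenvector.1 h _ ?_ w hA')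
    rw [Complex.div_re, ← add_div]
    refine div_nonneg ?_ (Complex.normSq_nonneg _)
    have h1 : 1 ≤ ‖z‖ ^ 2 := by nlinarith [not_lt.1 hz2]
    rw [← Complex.normSq_eq_norm_sq, Complex.normSq_apply] at h1
    simp only [Complex.sub_re, Complex.one_re, Complex.add_re, Complex.sub_im, Complex.one_im,
      Complex.add_im]
    linarith
  have hre : Continuous fun D : Matrix (Fin n) (Fin n) ℂ => D.map Complex.re :=
    continuous_id.matrix_map Complex.continuous_re
  have := (hre.tendsto 0).comp hC
  refine (this.congr fun k => ?_).trans_eq (by ext; simp)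
  rw [Function.comp_apply, ← map_pow]
  ext i j
  simp [hf]

/-- **Lyapunov's theorem**: the solution of a Lyapunov equation with Hurwitz coefficient and
positive semidefinite right-hand side is positive semidefinite. -/
theorem IsHurwitz.posSemidef_of_lyapunov {n : ℕ} {A H Q : Matrix (Fin n) (Fin n) ℝ}
    (h : IsHurwitz A) (hQ : Q.PosSemidef) (hH : Aᵀ * H + H * A + Q = 0) : H.PosSemidef := by
  have hQs : Qᵀ = Q := by simpa [Matrix.conjTranspose_eq_transpose_of_trivial] using hQ.1.eq
  have hs : H.IsSymm := by
    refine sub_eq_zero.1 (sylvester_eq_zero h.transpose h.transpose ?_)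
    have h2 := congrArg Matrix.transpose hH
    simp only [Matrix.transpose_add, Matrix.transpose_mul, Matrix.transpose_transpose, hQs,
      Matrix.transpose_zero] at h2
    rw [Matrix.transpose_transpose, ← sub_self (0 : Matrix (Fin n) (Fin n) ℝ)]
    nth_rewrite 1 [← h2]
    rw [← hH]
    noncomm_ring
  have hdet : IsUnit (1 - A).det := by
    rw [isUnit_iff_ne_zero]
    intro h0
    obtain ⟨v, hv0, hv⟩ := Matrix.exists_mulVec_eq_zero_iff.2 h0
    rw [Matrix.sub_mulVec, Matrix.one_mulVec, sub_eq_zero] at hv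
    apply hv0
    have := isHurwitz_iff_eigenvector.1 h 1 (by simp) (fun i => (v i : ℂ)) (by
      ext i
      have := congrFun hv i
      simp only [Matrix.mulVec, dotProduct] at this
      simp only [Matrix.mulVec, dotProduct, Matrix.map_apply, one_smul]
      rw [this]
      simp)
    ext i
    simpa using congrFun this i
  have hM := Matrix.mul_nonsing_inv (1 - A) hdet
  refine posSemidef_of_stein (h.tendsto_cayley_pow hM) hs ?_
  set M := (1 - A)⁻¹
  -- The Cayley transform turns the Lyapunov equation into a Stein equation, replacing integrals of
  -- matrix exponentials by powers.
  have e : H - ((1 + A) * M)ᵀ * H * ((1 + A) * M) = (2 : ℝ) • (Mᵀ * Q * M) := by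
    have e1 : H = ((1 - A) * M)ᵀ * H * ((1 - A) * M) := by rw [hM]; simp
    nth_rewrite 1 [e1]
    rw [eq_neg_of_add_eq_zero_right hH]
    simp only [Matrix.transpose_mul, Matrix.transpose_add, Matrix.transpose_sub,
      Matrix.transpose_one, two_smul]
    noncomm_ring
  rw [e]
  have := hQ.conjTranspose_mul_mul_same M
  rw [Matrix.conjTranspose_eq_transpose_of_trivial] at this
  exact this.smul (by norm_num)

/-- A real positive semidefinite matrix is positive semidefinite as a complex matrix. -/
theorem posSemidef_map_complex {n : ℕ} {H : Matrix (Fin n) (Fin n) ℝ} (hH : H.PosSemidef) :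
    (H.map (algebraMap ℝ ℂ)).PosSemidef := by
  open scoped MatrixOrder in
  obtain ⟨Y, hY⟩ := CStarAlgebra.nonneg_iff_eq_star_mul_self.1 (Matrix.nonneg_iff_posSemidef.2 hH)
  have e : H.map (algebraMap ℝ ℂ) = (Y.map (algebraMap ℝ ℂ))ᴴ * Y.map (algebraMap ℝ ℂ) := by
    rw [hY, Matrix.star_eq_conjTranspose, Matrix.map_mul]
    congr 1
    ext i j
    simp
  rw [e]
  exact Matrix.posSemidef_conjTranspose_mul_self _

/-! ### Resolvent bounds and stability under perturbation -/

/-- A bound `c` for the resolvent of `A` on the closed right half-plane, in the `ℓ²` norm. -/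
def ResolventBound {n : ℕ} (A : Matrix (Fin n) (Fin n) ℝ) (c : ℝ) : Prop :=
  ∀ z : ℂ, 0 ≤ z.re → ∀ v : EuclideanSpace ℂ (Fin n),
    ‖v‖ ≤ c * ‖z • v - Matrix.toEuclideanCLM (𝕜 := ℂ) (A.map (algebraMap ℝ ℂ)) v‖

theorem ResolventBound.isHurwitz {n : ℕ} {A : Matrix (Fin n) (Fin n) ℝ} {c : ℝ}
    (h : ResolventBound A c) : IsHurwitz A := by
  refine isHurwitz_iff_eigenvector.2 fun z hz v hv => ?_
  have h1 := h z hz (WithLp.toLp 2 v)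
  rw [Matrix.toEuclideanCLM_toLp, hv, WithLp.toLp_smul, sub_self, norm_zero, mul_zero] at h1
  simpa using norm_le_zero_iff.1 h1

theorem map_transpose_complex {a b : ℕ} (M : Matrix (Fin a) (Fin b) ℝ) :
    Mᵀ.map (algebraMap ℝ ℂ) = (M.map (algebraMap ℝ ℂ))ᴴ := by
  ext i j
  simp

/-- Take `H ⪰ 0` with `Aᵀ H + H A + 1 = 0` and put `y = z v - A v`. Pairing with `v` gives `‖v‖² =
-2 Re z ⟨H v, v⟩ + 2 Re ⟨H v, y⟩ ≤ 2 ‖H‖ ‖v‖ ‖y‖`, a bound uniform in `z`. The `+ 1` in the constant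
only makes it positive. -/
theorem IsHurwitz.exists_resolventBound {n : ℕ} {A : Matrix (Fin n) (Fin n) ℝ}
    (h : IsHurwitz A) : ∃ c, 0 < c ∧ ResolventBound A c := by
  obtain ⟨H, hH⟩ := h.exists_lyapunov 1
  have hpos := posSemidef_map_complex (h.posSemidef_of_lyapunov Matrix.PosSemidef.one hH)
  set TA := Matrix.toEuclideanCLM (𝕜 := ℂ) (A.map (algebraMap ℝ ℂ)) with hTA
  set TH := Matrix.toEuclideanCLM (𝕜 := ℂ) (H.map (algebraMap ℝ ℂ)) with hTH
  have heq : star TA * TH + TH * TA + 1 = 0 := by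
    have := congrArg (fun M => Matrix.toEuclideanCLM (𝕜 := ℂ) (n := Fin n)
      ((algebraMap ℝ ℂ).mapMatrix M)) hH
    simp only [map_add, map_mul, map_one, map_zero, RingHom.mapMatrix_apply,
      map_transpose_complex, ← Matrix.star_eq_conjTranspose, map_star] at this
    exact this
  have hsa : star TH = TH := by
    rw [hTH, ← map_star, Matrix.star_eq_conjTranspose, hpos.1.eq]
  have hnn : ∀ v : EuclideanSpace ℂ (Fin n), 0 ≤ (inner ℂ (TH v) v).re := by
    intro v
    have := hpos.re_dotProduct_nonneg v.ofLp
    rw [← Matrix.ofLp_toEuclideanCLM, dotProduct_comm, ← EuclideanSpace.inner_eq_star_dotProduct,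
      ← inner_conj_symm] at this
    exact this
  refine ⟨2 * ‖TH‖ + 1, by positivity, fun z hz v => ?_⟩
  rw [← hTA]
  set y := z • v - TA v with hy
  have hTAv : TA v = z • v - y := by rw [hy]; abel
  have h1 : inner ℂ (TA v) (TH v) + inner ℂ (TH v) (TA v) + inner ℂ v v = (0 : ℂ) := by
    have h2 : inner ℂ v ((star TA * TH + TH * TA + 1) v) = (0 : ℂ) := by rw [heq]; simp
    simp only [add_apply, inner_add_right, one_apply_eq_self] at h2
    have h3 : inner ℂ v ((star TA * TH) v) = inner ℂ (TA v) (TH v) :=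
      ContinuousLinearMap.adjoint_inner_right TA v (TH v)
    have h4 : inner ℂ v ((TH * TA) v) = inner ℂ (TH v) (TA v) := by
      nth_rewrite 1 [← hsa]
      exact ContinuousLinearMap.adjoint_inner_right TH v (TA v)
    rwa [h3, h4] at h2
  have h3 : ‖v‖ ^ 2 = -2 * (inner ℂ (TH v) (TA v)).re := by
    have := congrArg Complex.re h1
    rw [← inner_conj_symm (TA v) (TH v), inner_self_eq_norm_sq_to_K] at this
    simp only [Complex.add_re, Complex.conj_re, Complex.zero_re] at this
    norm_cast at this
    simp only [Complex.coe_algebraMap, Complex.ofReal_re] at this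
    linarith
  have hreal : (inner ℂ (TH v) v).im = 0 := by
    have : (starRingEnd ℂ) (inner ℂ (TH v) v) = inner ℂ (TH v) v := by
      rw [inner_conj_symm]
      nth_rewrite 2 [← hsa]
      rw [ContinuousLinearMap.star_eq_adjoint, ContinuousLinearMap.adjoint_inner_left]
    exact Complex.conj_eq_iff_im.1 this
  rw [hTAv, inner_sub_right, inner_smul_right, Complex.sub_re, Complex.mul_re, hreal, mul_zero,
    sub_zero] at h3
  have h4 : (inner ℂ (TH v) y).re ≤ ‖TH‖ * ‖v‖ * ‖y‖ :=
    (Complex.re_le_norm _).trans ((norm_inner_le_norm _ _).trans (by gcongr; exact TH.le_opNorm v))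
  have h5 := mul_nonneg hz (hnn v)
  rcases (norm_nonneg v).eq_or_lt with h0 | h0
  · rw [← h0]; positivity
  · have h6 : ‖v‖ * ‖v‖ ≤ ‖v‖ * (2 * ‖TH‖ * ‖y‖) := by nlinarith
    have h7 := le_of_mul_le_mul_left h6 h0
    nlinarith [norm_nonneg y]

theorem continuous_toEuclideanCLM_map {n : ℕ} :
    Continuous fun A : Matrix (Fin n) (Fin n) ℝ =>
      Matrix.toEuclideanCLM (𝕜 := ℂ) (A.map (algebraMap ℝ ℂ)) := by
  have h1 : Continuous fun A : Matrix (Fin n) (Fin n) ℝ => A.map (algebraMap ℝ ℂ) :=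
    continuous_id.matrix_map Complex.continuous_ofReal
  have h2 : Continuous fun A : Matrix (Fin n) (Fin n) ℂ => Matrix.toEuclideanCLM (𝕜 := ℂ) A :=
    LinearMap.continuous_of_finiteDimensional
      (Matrix.toEuclideanCLM (𝕜 := ℂ) (n := Fin n)).toAlgEquiv.toLinearMap
  exact h2.comp h1

/-- The resolvent bound on the closed right half-plane is locally uniform. -/
theorem IsHurwitz.eventually_resolventBound {n : ℕ} {A : Matrix (Fin n) (Fin n) ℝ}
    (h : IsHurwitz A) : ∃ c, 0 < c ∧ ∀ᶠ A' in 𝓝 A, ResolventBound A' c := by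
  obtain ⟨c, hc, hA⟩ := h.exists_resolventBound
  -- A perturbation of norm below `1 / (2 c)` costs at most `‖v‖ / 2`, which is absorbed on the left
  -- at the price of doubling `c`.
  refine ⟨2 * c, by positivity, ?_⟩
  have hcont := (continuous_toEuclideanCLM_map (n := n)).tendsto A
  rw [Metric.tendsto_nhds] at hcont
  filter_upwards [hcont (1 / (2 * c)) (by positivity)] with A' hA' z hz v
  rw [dist_eq_norm] at hA'
  have h1 := hA z hz v
  set T := Matrix.toEuclideanCLM (𝕜 := ℂ) (A.map (algebraMap ℝ ℂ))
  set T' := Matrix.toEuclideanCLM (𝕜 := ℂ) (A'.map (algebraMap ℝ ℂ))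
  have h2 : ‖z • v - T v‖ ≤ ‖z • v - T' v‖ + 1 / (2 * c) * ‖v‖ := by
    have : z • v - T v = (z • v - T' v) + (T' - T) v := by
      rw [sub_apply]; abel
    rw [this]
    refine (norm_add_le _ _).trans (add_le_add_right ?_ _)
    exact ((T' - T).le_opNorm v).trans (by gcongr)
  have h3 : c * (1 / (2 * c) * ‖v‖) = ‖v‖ / 2 := by field_simp
  nlinarith

theorem IsHurwitz.eventually {n : ℕ} {A : Matrix (Fin n) (Fin n) ℝ} (h : IsHurwitz A) :
    ∀ᶠ A' in 𝓝 A, IsHurwitz A' := by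
  obtain ⟨c, -, hc⟩ := h.eventually_resolventBound
  exact hc.mono fun _ h => h.isHurwitz

open scoped Matrix.Norms.L2Operator in
theorem ResolventBound.norm_resolvent_le {n : ℕ} {A : Matrix (Fin n) (Fin n) ℝ} {c : ℝ}
    (hc : 0 ≤ c) (h : ResolventBound A c) {z : ℂ} (hz : 0 ≤ z.re) :
    ‖(Matrix.scalar (Fin n) z - A.map (algebraMap ℝ ℂ))⁻¹‖ ≤ c := by
  set R := Matrix.scalar (Fin n) z - A.map (algebraMap ℝ ℂ) with hR
  have hRv : ∀ v : Fin n → ℂ, R *ᵥ v = z • v - A.map (algebraMap ℝ ℂ) *ᵥ v := by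
    intro v
    rw [hR, Matrix.sub_mulVec, Matrix.scalar_apply, ← Matrix.smul_one_eq_diagonal,
      Matrix.smul_mulVec, Matrix.one_mulVec]
  have hdet : IsUnit R.det := by
    rw [isUnit_iff_ne_zero]
    intro h0
    obtain ⟨v, hv0, hv⟩ := Matrix.exists_mulVec_eq_zero_iff.2 h0
    rw [hRv, sub_eq_zero] at hv
    exact hv0 (isHurwitz_iff_eigenvector.1 h.isHurwitz z hz v hv.symm)
  rw [Matrix.cstar_norm_def]
  refine ContinuousLinearMap.opNorm_le_bound _ hc fun x => ?_
  refine (h z hz _).trans_eq ?_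
  congr 2
  apply WithLp.ofLp_injective 2
  simp only [WithLp.ofLp_sub, WithLp.ofLp_smul, Matrix.ofLp_toEuclideanCLM]
  rw [← hRv, Matrix.mulVec_mulVec, Matrix.mul_nonsing_inv _ hdet, Matrix.one_mulVec]

open scoped Matrix.Norms.L2Operator in
/-- Near a stabilizing gain the `H_∞` norm is bounded and the gains are stabilizing. -/
theorem Data.eventually_hinfNorm_le {n m : ℕ} (P : Data n m) {K : Matrix (Fin m) (Fin n) ℝ}
    (h : IsHurwitz (P.AK K)) :
    ∃ c : ℝ, 0 < c ∧ ∀ᶠ K' in 𝓝 K, IsHurwitz (P.AK K') ∧ P.hinfNorm K' ≤ ENNReal.ofReal c := by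
  obtain ⟨c, hc, hA⟩ := h.eventually_resolventBound
  have hAK : Continuous P.AK := by unfold Data.AK; fun_prop
  let C : Matrix (Fin m) (Fin n) ℝ → Matrix (Fin n ⊕ Fin m) (Fin n) ℂ := fun K =>
    (Matrix.fromRows (psdSqrt P.Qi) (psdSqrt P.Ri * K)).map (algebraMap ℝ ℂ)
  have hC : Continuous C := by
    refine continuous_matrix fun i j => ?_
    rcases i with i | i
    · exact (continuous_const (X := Matrix (Fin m) (Fin n) ℝ) (y := (psdSqrt P.Qi i j : ℂ)))
    · have hc : Continuous fun K : Matrix (Fin m) (Fin n) ℝ => psdSqrt P.Ri * K := by fun_prop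
      exact Complex.continuous_ofReal.comp (hc.matrix_elem i j)
  have hCn : ∀ᶠ K' in 𝓝 K, ‖C K'‖ < ‖C K‖ + 1 :=
    (hC.norm.tendsto K).eventually (gt_mem_nhds (lt_add_one _))
  -- Product of bounds for the three factors of `T_∞`; the inner `+ 1` leaves room to vary `K`, the
  -- outer one ensures positivity.
  refine ⟨(‖C K‖ + 1) * c * ‖P.Bw.map (algebraMap ℝ ℂ)‖ + 1, by positivity, ?_⟩
  filter_upwards [(hAK.tendsto K).eventually hA, hCn] with K' hK' hCK'
  refine ⟨hK'.isHurwitz, iSup₂_le fun s hs => ENNReal.ofReal_le_ofReal ?_⟩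
  have h1 : ‖P.Tinf K' s‖ ≤ (‖C K‖ + 1) * c * ‖P.Bw.map (algebraMap ℝ ℂ)‖ := by
    refine (Matrix.l2_opNorm_mul _ _).trans ?_
    gcongr
    refine (Matrix.l2_opNorm_mul _ _).trans ?_
    refine mul_le_mul hCK'.le ?_ (norm_nonneg _) (by positivity)
    · exact hK'.norm_resolvent_le hc.le (le_of_lt hs)
  linarith

/-! ### Detectability and the LQR Riccati equation -/

theorem transpose_eq_of_posSemidef {k : ℕ} {M : Matrix (Fin k) (Fin k) ℝ} (h : M.PosSemidef) :
    Mᵀ = M := by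
  simpa [Matrix.conjTranspose_eq_transpose_of_trivial] using h.1.eq

theorem posSemidef_transpose_mul_mul {k l : ℕ} {M : Matrix (Fin k) (Fin k) ℝ}
    (h : M.PosSemidef) (K : Matrix (Fin k) (Fin l) ℝ) : (Kᵀ * M * K).PosSemidef := by
  simpa [Matrix.conjTranspose_eq_transpose_of_trivial] using h.conjTranspose_mul_mul_same K

/-- An eigenvector for an unstable eigenvalue annihilates the right-hand side of a Lyapunov
equation with positive semidefinite solution. -/
theorem dotProduct_eq_zero_of_lyapunov {n : ℕ} {A H Q : Matrix (Fin n) (Fin n) ℝ}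
    (hH : H.PosSemidef) (hQ : Q.PosSemidef) (h : Aᵀ * H + H * A + Q = 0) {z : ℂ}
    (hz : 0 ≤ z.re) {v : Fin n → ℂ} (hv : A.map (algebraMap ℝ ℂ) *ᵥ v = z • v) :
    star v ⬝ᵥ (Q.map (algebraMap ℝ ℂ) *ᵥ v) = 0 := by
  have hHc := posSemidef_map_complex hH
  have hQc := posSemidef_map_complex hQ
  set f : Matrix (Fin n) (Fin n) ℝ →+* Matrix (Fin n) (Fin n) ℂ := (algebraMap ℝ ℂ).mapMatrix
    with hf
  have hT : f Aᵀ = (f A)ᴴ := by ext i j; simp [hf]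
  have h1 := congrArg (fun M => star v ⬝ᵥ (f M *ᵥ v)) h
  simp only [map_add, map_mul, map_zero, hT, Matrix.add_mulVec, dotProduct_add,
    Matrix.zero_mulVec, dotProduct_zero, ← Matrix.mulVec_mulVec] at h1
  have hv' : f A *ᵥ v = z • v := hv
  rw [Matrix.dotProduct_mulVec (star v) (f A)ᴴ, ← Matrix.star_mulVec, hv', Matrix.mulVec_smul,
    star_smul, smul_dotProduct, dotProduct_smul, smul_eq_mul, smul_eq_mul, ← add_mul] at h1
  have h2 : star z + z = ((2 * z.re : ℝ) : ℂ) := by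
    rw [add_comm]; exact Complex.add_conj z
  rw [h2] at h1
  have h3 := hHc.dotProduct_mulVec_nonneg v
  have h4 := hQc.dotProduct_mulVec_nonneg v
  have h5 : 0 ≤ ((2 * z.re : ℝ) : ℂ) * (star v ⬝ᵥ (H.map (algebraMap ℝ ℂ) *ᵥ v)) :=
    mul_nonneg (Complex.zero_le_real.2 (by positivity)) h3
  exact ((add_eq_zero_iff_of_nonneg h5 h4).1 h1).2

/-- A closed loop admitting a positive semidefinite solution of the Lyapunov inequality for the
quadratic cost is Hurwitz when the cost is detectable. -/
theorem isHurwitz_of_detectable {n m : ℕ} {A : Matrix (Fin n) (Fin n) ℝ}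
    {B : Matrix (Fin n) (Fin m) ℝ} {Q H N : Matrix (Fin n) (Fin n) ℝ}
    {R : Matrix (Fin m) (Fin m) ℝ} {K : Matrix (Fin m) (Fin n) ℝ} (hQ : Q.PosSemidef)
    (hR : R.PosDef) (hN : N.PosSemidef) (hdet : IsDetectable (psdSqrt Q) A) (hH : H.PosSemidef)
    (h : (A + B * K)ᵀ * H + H * (A + B * K) + (Q + Kᵀ * R * K + N) = 0) :
    IsHurwitz (A + B * K) := by
  obtain ⟨L, hL⟩ := hdet
  refine isHurwitz_iff_eigenvector.2 fun z hz v hv => ?_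
  have hKRK := posSemidef_transpose_mul_mul hR.posSemidef K
  -- An unstable eigenvector `v` of `A + B K` has zero cost, so `K v = 0` and `Q^{1/2} v = 0`. It is
  -- then an eigenvector of `A + L Q^{1/2}` for the same `z`, which detectability excludes.
  have h0 := dotProduct_eq_zero_of_lyapunov hH ((hQ.add hKRK).add hN) h hz hv
  rw [Matrix.map_add _ (map_add _), Matrix.map_add _ (map_add _), Matrix.add_mulVec,
    Matrix.add_mulVec, dotProduct_add, dotProduct_add] at h0
  have hq1 := (posSemidef_map_complex hQ).dotProduct_mulVec_nonneg v
  have hq2 := (posSemidef_map_complex hKRK).dotProduct_mulVec_nonneg v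
  have hq3 := (posSemidef_map_complex hN).dotProduct_mulVec_nonneg v
  obtain ⟨h1, -⟩ := (add_eq_zero_iff_of_nonneg (add_nonneg hq1 hq2) hq3).1 h0
  obtain ⟨h1, h2⟩ := (add_eq_zero_iff_of_nonneg hq1 hq2).1 h1
  have hKv : K.map (algebraMap ℝ ℂ) *ᵥ v = 0 := by
    have e : (Kᵀ * R * K).map (algebraMap ℝ ℂ) = (K.map (algebraMap ℝ ℂ))ᴴ *
        (R.map (algebraMap ℝ ℂ) * K.map (algebraMap ℝ ℂ)) := by
      rw [Matrix.map_mul, Matrix.map_mul, Matrix.mul_assoc]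
      congr 1
      ext i j
      simp
    rw [e, ← Matrix.mulVec_mulVec, Matrix.dotProduct_mulVec, ← Matrix.star_mulVec,
      ← Matrix.mulVec_mulVec,
      (posSemidef_map_complex hR.posSemidef).dotProduct_mulVec_zero_iff] at h2
    have hu : R⁻¹ * R = 1 := Matrix.nonsing_inv_mul _ ((Matrix.isUnit_iff_isUnit_det _).1 hR.isUnit)
    have hu' := congrArg (fun M => M.map (algebraMap ℝ ℂ)) hu
    simp only [Matrix.map_mul, Matrix.map_one _ (map_zero (algebraMap ℝ ℂ)) (map_one _)] at hu'
    rw [← Matrix.one_mulVec (K.map (algebraMap ℝ ℂ) *ᵥ v), ← hu', ← Matrix.mulVec_mulVec, h2,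
      Matrix.mulVec_zero]
  have hSv : (psdSqrt Q).map (algebraMap ℝ ℂ) *ᵥ v = 0 := by
    open scoped MatrixOrder in
    have hS : psdSqrt Q * psdSqrt Q = Q :=
      CFC.sqrt_mul_sqrt_self Q (Matrix.nonneg_iff_posSemidef.2 hQ)
    open scoped MatrixOrder in
    have hSt : (psdSqrt Q).PosSemidef := Matrix.nonneg_iff_posSemidef.1 (CFC.sqrt_nonneg Q)
    have e : Q.map (algebraMap ℝ ℂ) = ((psdSqrt Q).map (algebraMap ℝ ℂ))ᴴ *
        (psdSqrt Q).map (algebraMap ℝ ℂ) := by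
      rw [(posSemidef_map_complex hSt).1.eq, ← Matrix.map_mul, hS]
    rw [e, ← Matrix.mulVec_mulVec, Matrix.dotProduct_mulVec, ← Matrix.star_mulVec,
      dotProduct_star_self_eq_zero] at h1
    exact h1
  refine isHurwitz_iff_eigenvector.1 hL z hz v ?_
  rw [Matrix.map_add _ (map_add _), Matrix.map_mul, Matrix.add_mulVec, ← Matrix.mulVec_mulVec] at hv ⊢
  rw [hKv, Matrix.mulVec_zero, add_zero] at hv
  rw [hSv, hv, Matrix.mulVec_zero, add_zero]

theorem isClosed_posSemidef {n : ℕ} :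
    IsClosed {M : Matrix (Fin n) (Fin n) ℝ | M.PosSemidef} := by
  have e : {M : Matrix (Fin n) (Fin n) ℝ | M.PosSemidef} =
      {M | Mᵀ = M} ∩ ⋂ x : Fin n → ℝ, {M | 0 ≤ x ⬝ᵥ (M *ᵥ x)} := by
    ext M
    simp only [Set.mem_ofPred_eq, Set.mem_inter_iff, Set.mem_iInter]
    exact ⟨fun h => ⟨transpose_eq_of_posSemidef h, fun x => by
      simpa using h.dotProduct_mulVec_nonneg x⟩,
      fun h => posSemidef_of_forall_dotProduct h.1 h.2⟩
  rw [e]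
  refine (isClosed_eq (by fun_prop) (by fun_prop)).inter (isClosed_iInter fun x => ?_)
  exact isClosed_le (by fun_prop) (by fun_prop)

/-- Testing on `e_i ± e_j` gives `2 |M i j| ≤ M i i + M j j`. The trace thus controls all entries,
which supplies the compactness needed to minimize it. -/
theorem abs_apply_le_trace {n : ℕ} {M : Matrix (Fin n) (Fin n) ℝ} (h : M.PosSemidef)
    (i j : Fin n) : |M i j| ≤ M.trace := by
  have hd : ∀ i, M i i ≤ M.trace := fun i =>
    Finset.single_le_sum (f := fun i => M i i) (fun i _ => h.diag_nonneg) (Finset.mem_univ i)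
  have hs : M j i = M i j := congrFun (congrFun (transpose_eq_of_posSemidef h) i) j
  have h1 := h.dotProduct_mulVec_nonneg (Pi.single i 1 + Pi.single j 1)
  have h2 := h.dotProduct_mulVec_nonneg (Pi.single i 1 - Pi.single j 1)
  simp [Matrix.mulVec_add, Matrix.mulVec_sub, hs] at h1 h2
  have := hd i
  have := hd j
  rw [abs_le]
  constructor <;> linarith

theorem isCompact_posSemidef_trace_le {n : ℕ} (c : ℝ) :
    IsCompact {M : Matrix (Fin n) (Fin n) ℝ | M.PosSemidef ∧ M.trace ≤ c} := by
  have hK : IsCompact (X := Matrix (Fin n) (Fin n) ℝ)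
      (Set.univ.pi fun _ => Set.univ.pi fun _ => Set.Icc (-c) c) :=
    isCompact_univ_pi fun _ => isCompact_univ_pi fun _ => isCompact_Icc
  refine hK.of_isClosed_subset
    (isClosed_posSemidef.inter (isClosed_le continuous_id.matrix_trace continuous_const)) ?_
  rintro M ⟨hM, hc⟩ i - j -
  exact abs_le.1 ((abs_apply_le_trace hM i j).trans hc)

/-- Completion of squares in the Lyapunov operator of the closed loop. -/
theorem lyapunov_eq_riccati_add {n m : ℕ} (A : Matrix (Fin n) (Fin n) ℝ)
    (B : Matrix (Fin n) (Fin m) ℝ) (Q : Matrix (Fin n) (Fin n) ℝ)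
    {R : Matrix (Fin m) (Fin m) ℝ} (hR : R.PosDef) (K : Matrix (Fin m) (Fin n) ℝ)
    {H : Matrix (Fin n) (Fin n) ℝ} (hH : Hᵀ = H) :
    (A + B * K)ᵀ * H + H * (A + B * K) + (Q + Kᵀ * R * K) =
      Aᵀ * H + H * A + Q - H * B * R⁻¹ * Bᵀ * H +
        (K + R⁻¹ * Bᵀ * H)ᵀ * R * (K + R⁻¹ * Bᵀ * H) := by
  have hu := (Matrix.isUnit_iff_isUnit_det _).1 hR.isUnit
  have hRt := transpose_eq_of_posSemidef hR.posSemidef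
  have hit : (R⁻¹)ᵀ = R⁻¹ := by rw [Matrix.transpose_nonsing_inv, hRt]
  have e1 : R⁻¹ * R = 1 := Matrix.nonsing_inv_mul _ hu
  have e2 : R * R⁻¹ = 1 := Matrix.mul_nonsing_inv _ hu
  have e3 : R * (K + R⁻¹ * Bᵀ * H) = R * K + Bᵀ * H := by
    rw [Matrix.mul_add, Matrix.mul_assoc R⁻¹, ← Matrix.mul_assoc R, e2, Matrix.one_mul]
  have e4 : H * B * R⁻¹ * (R * K) = H * B * K := by
    rw [Matrix.mul_assoc, ← Matrix.mul_assoc R⁻¹, e1, Matrix.one_mul]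
  rw [Matrix.mul_assoc (K + R⁻¹ * Bᵀ * H)ᵀ R, e3]
  simp only [Matrix.transpose_add, Matrix.transpose_mul, hH, hit, Matrix.transpose_transpose,
    Matrix.add_mul, Matrix.mul_add, ← Matrix.mul_assoc] at e4 ⊢
  rw [e4]
  abel

/-- **Existence of the LQR gain**: for stabilizable and detectable data the algebraic Riccati
equation has a positive semidefinite stabilizing solution. -/
theorem exists_lqr {n m : ℕ} {A : Matrix (Fin n) (Fin n) ℝ}
    {B : Matrix (Fin n) (Fin m) ℝ} {Q : Matrix (Fin n) (Fin n) ℝ}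
    {R : Matrix (Fin m) (Fin m) ℝ} (hQ : Q.PosSemidef) (hR : R.PosDef)
    (hstab : IsStabilizable A B) (hdet : IsDetectable (psdSqrt Q) A) :
    ∃ (K : Matrix (Fin m) (Fin n) ℝ) (H : Matrix (Fin n) (Fin n) ℝ), H.PosSemidef ∧ IsHurwitz (A + B * K) ∧
      R * K + Bᵀ * H = 0 ∧ (A + B * K)ᵀ * H + H * (A + B * K) + (Q + Kᵀ * R * K) = 0 := by
  -- `N` is minus the Riccati operator, so `N H ⪰ 0` says that `H` is a supersolution. By completion
  -- of squares, the cost matrix of any stabilizing gain is one.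
  let N : Matrix (Fin n) (Fin n) ℝ → Matrix (Fin n) (Fin n) ℝ := fun H =>
    H * B * R⁻¹ * Bᵀ * H - (Aᵀ * H + H * A + Q)
  have hNc : Continuous N := by fun_prop
  have step : ∀ K : Matrix (Fin m) (Fin n) ℝ, IsHurwitz (A + B * K) → ∃ H : Matrix (Fin n) (Fin n) ℝ, H.PosSemidef ∧
      (N H).PosSemidef ∧ (A + B * K)ᵀ * H + H * (A + B * K) + (Q + Kᵀ * R * K) = 0 := by
    intro K hK
    obtain ⟨H, hH⟩ := hK.exists_lyapunov (Q + Kᵀ * R * K)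
    have hp := hK.posSemidef_of_lyapunov
      (hQ.add (posSemidef_transpose_mul_mul hR.posSemidef K)) hH
    refine ⟨H, hp, ?_, hH⟩
    have h1 := lyapunov_eq_riccati_add A B Q hR K (transpose_eq_of_posSemidef hp)
    rw [hH] at h1
    have h2 : N H = (K + R⁻¹ * Bᵀ * H)ᵀ * R * (K + R⁻¹ * Bᵀ * H) := by
      rw [eq_neg_of_add_eq_zero_right h1.symm]
      simp only [N]
      abel
    rw [h2]
    exact posSemidef_transpose_mul_mul hR.posSemidef _
  obtain ⟨K₀, hK₀⟩ := hstab
  obtain ⟨H₀, hH₀, hN₀, -⟩ := step K₀ hK₀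
  -- A supersolution of least trace will solve the Riccati equation; the bound by the trace of `H₀`
  -- makes the search compact.
  obtain ⟨H, ⟨⟨hH, hHt⟩, hN⟩, hmin⟩ := ((isCompact_posSemidef_trace_le H₀.trace).inter_right
    (isClosed_posSemidef.preimage hNc)).exists_isMinOn ⟨H₀, ⟨hH₀, le_rfl⟩, hN₀⟩
    (f := Matrix.trace) (by fun_prop)
  have hu := (Matrix.isUnit_iff_isUnit_det _).1 hR.isUnit
  -- One step of policy iteration from the minimizer: this gain makes the completed square vanish,
  -- and its cost matrix `H'` satisfies `H' ⪯ H`. Minimality equates the traces, hence `H = H'`.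
  set K := -(R⁻¹ * Bᵀ * H) with hKdef
  have hlyap : (A + B * K)ᵀ * H + H * (A + B * K) + (Q + Kᵀ * R * K + N H) = 0 := by
    rw [← add_assoc, lyapunov_eq_riccati_add A B Q hR K (transpose_eq_of_posSemidef hH), hKdef,
      neg_add_cancel, Matrix.mul_zero, add_zero]
    simp only [N]
    abel
  have hK := isHurwitz_of_detectable hQ hR hN hdet hH hlyap
  obtain ⟨H', hH', hN', hlyap'⟩ := step K hK
  have hD : (H - H').PosSemidef := by
    refine hK.posSemidef_of_lyapunov hN ?_
    rw [← sub_zero (0 : Matrix (Fin n) (Fin n) ℝ)]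
    nth_rewrite 1 [← hlyap]
    rw [← hlyap', Matrix.mul_sub, Matrix.sub_mul]
    abel
  have htr : H'.trace ≤ H.trace := by
    have := hD.trace_nonneg
    rwa [Matrix.trace_sub, sub_nonneg] at this
  have htr' : H.trace ≤ H'.trace := hmin ⟨⟨hH', htr.trans hHt⟩, hN'⟩
  have hHH : H = H' := by
    rw [← sub_eq_zero, ← hD.trace_eq_zero_iff, Matrix.trace_sub, sub_eq_zero]
    exact le_antisymm htr' htr
  refine ⟨K, H, hH, hK, ?_, ?_⟩
  · rw [hKdef, Matrix.mul_neg, Matrix.mul_assoc R⁻¹, ← Matrix.mul_assoc R,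
      Matrix.mul_nonsing_inv _ hu, Matrix.one_mul, neg_add_cancel]
  · rw [hHH]
    exact hlyap'

/-! ### Calculus of explicit differentials and the implicit function theorem -/

section Differential

variable {E F G : Type*} [NormedAddCommGroup E] [NormedSpace ℝ E] [NormedAddCommGroup F]
  [NormedSpace ℝ F] [NormedAddCommGroup G] [NormedSpace ℝ G]

/-- `f` is strictly differentiable at `u`, and `D` is its differential as a plain function. -/
def HasStrictDifferentialAt (f D : E → F) (u : E) : Prop :=
  ∃ f' : E →L[ℝ] F, HasStrictFDerivAt f f' u ∧ ∀ h, f' h = D h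

namespace HasStrictDifferentialAt

theorem const (c : F) (u : E) : HasStrictDifferentialAt (fun _ => c) (fun _ => 0) u :=
  ⟨0, hasStrictFDerivAt_const c u, fun _ => rfl⟩

theorem clm (L : E →L[ℝ] F) (u : E) : HasStrictDifferentialAt L L u :=
  ⟨L, L.hasStrictFDerivAt, fun _ => rfl⟩

theorem id (u : E) : HasStrictDifferentialAt (fun x : E => x) (fun h => h) u :=
  clm (ContinuousLinearMap.id ℝ E) u

theorem fst {f Df : E → F × G} {u : E} (hf : HasStrictDifferentialAt f Df u) :
    HasStrictDifferentialAt (fun x => (f x).1) (fun h => (Df h).1) u := by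
  obtain ⟨f', hf, hf'⟩ := hf
  exact ⟨(ContinuousLinearMap.fst ℝ F G).comp f', hf.fst, fun h => by simp [hf']⟩

theorem snd {f Df : E → F × G} {u : E} (hf : HasStrictDifferentialAt f Df u) :
    HasStrictDifferentialAt (fun x => (f x).2) (fun h => (Df h).2) u := by
  obtain ⟨f', hf, hf'⟩ := hf
  exact ⟨(ContinuousLinearMap.snd ℝ F G).comp f', hf.snd, fun h => by simp [hf']⟩

theorem add {f g Df Dg : E → F} {u : E} (hf : HasStrictDifferentialAt f Df u)
    (hg : HasStrictDifferentialAt g Dg u) :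
    HasStrictDifferentialAt (fun x => f x + g x) (fun h => Df h + Dg h) u := by
  obtain ⟨f', hf, hf'⟩ := hf
  obtain ⟨g', hg, hg'⟩ := hg
  exact ⟨f' + g', hf.add hg, fun h => by rw [add_apply, hf', hg']⟩

theorem smul {f Df : E → ℝ} {g Dg : E → F} {u : E} (hf : HasStrictDifferentialAt f Df u)
    (hg : HasStrictDifferentialAt g Dg u) :
    HasStrictDifferentialAt (fun x => f x • g x) (fun h => Df h • g u + f u • Dg h) u := by
  obtain ⟨f', hf, hf'⟩ := hf
  obtain ⟨g', hg, hg'⟩ := hg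
  refine ⟨_, hf.smul hg, fun h => ?_⟩
  rw [add_apply, add_comm]
  simp [hf', hg']

theorem prodMk {f Df : E → F} {g Dg : E → G} {u : E} (hf : HasStrictDifferentialAt f Df u)
    (hg : HasStrictDifferentialAt g Dg u) :
    HasStrictDifferentialAt (fun x => (f x, g x)) (fun h => (Df h, Dg h)) u := by
  obtain ⟨f', hf, hf'⟩ := hf
  obtain ⟨g', hg, hg'⟩ := hg
  exact ⟨_, hf.prodMk hg, fun h => by simp [hf', hg']⟩

theorem clm_comp {f Df : E → F} {u : E} (L : F →L[ℝ] G) (hf : HasStrictDifferentialAt f Df u) :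
    HasStrictDifferentialAt (fun x => L (f x)) (fun h => L (Df h)) u := by
  obtain ⟨f', hf, hf'⟩ := hf
  exact ⟨L.comp f', L.hasStrictFDerivAt.comp u hf, fun h => by simp [hf']⟩

theorem bilinear {H : Type*} [NormedAddCommGroup H] [NormedSpace ℝ H] {f Df : E → F}
    {g Dg : E → G} {u : E} (hf : HasStrictDifferentialAt f Df u) (L : F →L[ℝ] G →L[ℝ] H)
    (hg : HasStrictDifferentialAt g Dg u) :
    HasStrictDifferentialAt (fun x => L (f x) (g x)) (fun h => L (Df h) (g u) + L (f u) (Dg h))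
      u := by
  obtain ⟨f', hf, hf'⟩ := hf
  obtain ⟨g', hg, hg'⟩ := hg
  refine ⟨_, L.hasStrictFDerivAt_of_bilinear hf hg, fun h => ?_⟩
  rw [add_apply, add_comm, ContinuousLinearMap.precompR_apply, ContinuousLinearMap.precompL_apply,
    ContinuousLinearMap.compL_apply, ContinuousLinearMap.comp_apply, hf', hg']

open scoped Matrix.Norms.Elementwise

/-- The elementwise sup norm is not submultiplicative in general, so continuity of the product as a
bilinear map comes from finite dimension. -/
theorem matrix_mul {a b c : ℕ} {f Df : E → Matrix (Fin a) (Fin b) ℝ}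
    {g Dg : E → Matrix (Fin b) (Fin c) ℝ} {u : E} (hf : HasStrictDifferentialAt f Df u)
    (hg : HasStrictDifferentialAt g Dg u) :
    HasStrictDifferentialAt (fun x => f x * g x) (fun h => Df h * g u + f u * Dg h) u := by
  let L : Matrix (Fin a) (Fin b) ℝ →L[ℝ] Matrix (Fin b) (Fin c) ℝ →L[ℝ]
      Matrix (Fin a) (Fin c) ℝ :=
    LinearMap.toContinuousLinearMap ((LinearMap.toContinuousLinearMap :
      (Matrix (Fin b) (Fin c) ℝ →ₗ[ℝ] Matrix (Fin a) (Fin c) ℝ) ≃ₗ[ℝ] _).toLinearMap ∘ₗ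
      LinearMap.mk₂ ℝ (fun M N => M * N) Matrix.add_mul (fun c M N => Matrix.smul_mul c M N)
        Matrix.mul_add (fun c M N => Matrix.mul_smul M c N))
  exact hf.bilinear L hg

theorem matrix_transpose {a b : ℕ} {f Df : E → Matrix (Fin a) (Fin b) ℝ} {u : E}
    (hf : HasStrictDifferentialAt f Df u) :
    HasStrictDifferentialAt (fun x => (f x)ᵀ) (fun h => (Df h)ᵀ) u :=
  hf.clm_comp (LinearMap.toContinuousLinearMap
    (Matrix.transposeLinearEquiv (Fin a) (Fin b) ℝ ℝ).toLinearMap)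

theorem matrix_trace {a : ℕ} {f Df : E → Matrix (Fin a) (Fin a) ℝ} {u : E}
    (hf : HasStrictDifferentialAt f Df u) :
    HasStrictDifferentialAt (fun x => (f x).trace) (fun h => (Df h).trace) u :=
  hf.clm_comp (LinearMap.toContinuousLinearMap (Matrix.traceLinearMap (Fin a) ℝ ℝ))

/-- The implicit function theorem in finite dimension: only injectivity of the partial
differential has to be checked. -/
theorem exists_implicit [FiniteDimensional ℝ E] [FiniteDimensional ℝ F] {f D : E × F → F} {x : E}
    {y : F} (hf : HasStrictDifferentialAt f D (x, y)) (h0 : f (x, y) = 0)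
    (hinj : ∀ k, D (0, k) = 0 → k = 0) :
    ∃ φ Dφ : E → F, HasStrictDifferentialAt φ Dφ x ∧ φ x = y ∧ (∀ᶠ x' in 𝓝 x, f (x', φ x') = 0) ∧
      ∀ h, D (h, Dφ h) = 0 := by
  have : CompleteSpace E := FiniteDimensional.complete ℝ E
  have : CompleteSpace F := FiniteDimensional.complete ℝ F
  obtain ⟨f', hf, hf'⟩ := hf
  -- The partial differential is an endomorphism of the finite-dimensional space `F`, so injectivity
  -- makes it invertible.
  have hi : Function.Injective (f' ∘L .inr ℝ E F) := by
    rw [injective_iff_map_eq_zero]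
    intro k hk
    apply hinj k
    rw [← hf']
    simpa using hk
  have hinv : (f' ∘L .inr ℝ E F).IsInvertible :=
    ⟨(LinearEquiv.ofInjectiveEndo (f' ∘L .inr ℝ E F).toLinearMap hi).toContinuousLinearEquiv,
      by ext; rfl⟩
  have hφ := hf.hasStrictFDerivAt_implicitFunctionOfProdDomain hinv
  have hev := hf.eventually_apply_implicitFunctionOfProdDomain hinv
  have hx := (hf.eventually_apply_eq_iff_implicitFunctionOfProdDomain hinv).self_of_nhds.1 rfl
  refine ⟨_, _, ⟨_, hφ, fun _ => rfl⟩, hx, by simpa only [h0] using hev, fun h => ?_⟩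
  set φ' := -(f' ∘L .inr ℝ E F).inverse ∘L (f' ∘L .inl ℝ E F) with hφ'
  have h1 : f' (h, φ' h) = f' (h, 0) + (f' ∘L .inr ℝ E F) (φ' h) := by
    rw [ContinuousLinearMap.comp_apply, ContinuousLinearMap.inr_apply, ← map_add]
    simp
  rw [← hf', h1, hφ']
  set T := f' ∘L .inr ℝ E F
  have h2 : (-T.inverse ∘L (f' ∘L .inl ℝ E F)) h = -T.inverse (f' (h, 0)) := rfl
  rw [h2, map_neg, hinv.self_apply_inverse, add_neg_cancel]

theorem continuousAt {f D : E → F} {u : E} (hf : HasStrictDifferentialAt f D u) :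
    ContinuousAt f u := by
  obtain ⟨f', hf, -⟩ := hf
  exact hf.continuousAt

end HasStrictDifferentialAt

end Differential

/-! ### The Riccati map and the gradient of the mixed cost -/

namespace Data

variable {n m : ℕ} (P : Data n m)

theorem SK_transpose (hQi : P.Qi.PosSemidef) (hRi : P.Ri.PosSemidef)
    (K : Matrix (Fin m) (Fin n) ℝ) : (P.SK K)ᵀ = P.SK K := by
  simp [SK, transpose_eq_of_posSemidef hQi, transpose_eq_of_posSemidef hRi, Matrix.mul_assoc]

theorem W_posSemidef : P.W.PosSemidef := by
  simpa [W, Matrix.conjTranspose_eq_transpose_of_trivial] using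
    Matrix.posSemidef_self_mul_conjTranspose P.Bw

/-- The left-hand side of the Riccati equation, with `e` in place of `β⁻²`. -/
def riccatiMap (e : ℝ) (K : Matrix (Fin m) (Fin n) ℝ) (X : Matrix (Fin n) (Fin n) ℝ) :
    Matrix (Fin n) (Fin n) ℝ :=
  P.AK K * X + X * (P.AK K)ᵀ + e • (X * P.SK K * X) + P.W

/-- A solution of the Riccati equation is symmetric as soon as `A_K + e X S_K` and
`A_K + e Xᵀ S_K` are Hurwitz. -/
theorem isSymm_of_riccatiMap_eq_zero (hQi : P.Qi.PosSemidef) (hRi : P.Ri.PosSemidef) {e : ℝ}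
    {K : Matrix (Fin m) (Fin n) ℝ} {X : Matrix (Fin n) (Fin n) ℝ}
    (h : P.riccatiMap e K X = 0) (h2 : IsHurwitz (P.AK K + e • (Xᵀ * P.SK K))) : X.IsSymm := by
  have hS := P.SK_transpose hQi hRi K
  have hW := transpose_eq_of_posSemidef P.W_posSemidef
  -- `Xᵀ` solves the same equation, and subtracting gives a Sylvester equation for `X - Xᵀ` with
  -- coefficient `A_K + e Xᵀ S_K` on both sides.
  refine (sub_eq_zero.1 (sylvester_eq_zero h2 h2 ?_)).symm
  have ht := congrArg Matrix.transpose h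
  rw [← sub_self (0 : Matrix (Fin n) (Fin n) ℝ)]
  nth_rewrite 1 [← h]
  rw [← ht.trans Matrix.transpose_zero]
  simp only [riccatiMap, Matrix.transpose_add, Matrix.transpose_smul, Matrix.transpose_mul, hS, hW,
    Matrix.transpose_transpose, add_mul, mul_add, mul_sub, sub_mul, smul_mul_assoc,
    mul_smul_comm, smul_sub, ← mul_assoc]
  abel

section Differential

open scoped Matrix.Norms.Elementwise

variable {E : Type*} [NormedAddCommGroup E] [NormedSpace ℝ E] {u : E}
  {e De : E → ℝ} {k Dk : E → Matrix (Fin m) (Fin n) ℝ} {x Dx : E → Matrix (Fin n) (Fin n) ℝ}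

theorem hasStrictDifferentialAt_AK (hk : HasStrictDifferentialAt k Dk u) :
    HasStrictDifferentialAt (fun p => P.AK (k p)) (fun h => P.B * Dk h) u := by
  have := (HasStrictDifferentialAt.const P.A u).add
    ((HasStrictDifferentialAt.const P.B u).matrix_mul hk)
  unfold AK
  simpa only [zero_add, Matrix.zero_mul] using this

theorem hasStrictDifferentialAt_quadratic (Q : Matrix (Fin n) (Fin n) ℝ)
    (R : Matrix (Fin m) (Fin m) ℝ) (hk : HasStrictDifferentialAt k Dk u) :
    HasStrictDifferentialAt (fun p => Q + (k p)ᵀ * R * k p)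
      (fun h => (Dk h)ᵀ * R * k u + (k u)ᵀ * R * Dk h) u := by
  have := (HasStrictDifferentialAt.const Q u).add
    ((hk.matrix_transpose.matrix_mul (HasStrictDifferentialAt.const R u)).matrix_mul hk)
  simpa only [zero_add, Matrix.mul_zero, add_zero] using this

theorem hasStrictDifferentialAt_SK (hk : HasStrictDifferentialAt k Dk u) :
    HasStrictDifferentialAt (fun p => P.SK (k p))
      (fun h => (Dk h)ᵀ * P.Ri * k u + (k u)ᵀ * P.Ri * Dk h) u :=
  hasStrictDifferentialAt_quadratic P.Qi P.Ri hk

/-- The scalar `e` is a variable because the continuation argument moves it, while the gradient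
computation keeps it constant. -/
theorem hasStrictDifferentialAt_riccatiMap (he : HasStrictDifferentialAt e De u)
    (hk : HasStrictDifferentialAt k Dk u) (hx : HasStrictDifferentialAt x Dx u) :
    HasStrictDifferentialAt (fun p => P.riccatiMap (e p) (k p) (x p))
      (fun h => P.B * Dk h * x u + P.AK (k u) * Dx h +
        (Dx h * (P.AK (k u))ᵀ + x u * (P.B * Dk h)ᵀ) +
        (De h • (x u * P.SK (k u) * x u) + e u • ((Dx h * P.SK (k u) +
          x u * ((Dk h)ᵀ * P.Ri * k u + (k u)ᵀ * P.Ri * Dk h)) * x u +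
          x u * P.SK (k u) * Dx h)) + 0) u := by
  have hA := P.hasStrictDifferentialAt_AK hk
  exact (((hA.matrix_mul hx).add (hx.matrix_mul hA.matrix_transpose)).add
    (he.smul ((hx.matrix_mul (P.hasStrictDifferentialAt_SK hk)).matrix_mul hx))).add
    (HasStrictDifferentialAt.const P.W u)

end Differential

/-- The first variation of the cost along a solution of the linearized Riccati equation vanishes
at a solution of the coupled optimality system. -/
theorem trace_differential_eq_zero (hR₂ : P.R₂.PosDef) (hQi : P.Qi.PosSemidef)
    (hRi : P.Ri.PosSemidef) {β : ℝ} {K : Matrix (Fin m) (Fin n) ℝ}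
    {X Γ : Matrix (Fin n) (Fin n) ℝ} (h : P.SolvesOptimalitySystem β K X Γ)
    (H : Matrix (Fin m) (Fin n) ℝ) (D : Matrix (Fin n) (Fin n) ℝ)
    (hD : P.B * H * X + P.AK K * D + (D * (P.AK K)ᵀ + X * (P.B * H)ᵀ) +
      ((0 : ℝ) • (X * P.SK K * X) + (β ^ 2)⁻¹ • ((D * P.SK K +
        X * (Hᵀ * P.Ri * K + Kᵀ * P.Ri * H)) * X + X * P.SK K * D)) + 0 = 0) :
    ((Hᵀ * P.R₂ * K + Kᵀ * P.R₂ * H) * X + (P.Q₂ + Kᵀ * P.R₂ * K) * D).trace = 0 := by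
  set e := (β ^ 2)⁻¹ with he
  have hXt : Xᵀ = X := h.stabilizing.isSymm
  have hΓt := transpose_eq_of_posSemidef h.posΓ
  have hR₂t := transpose_eq_of_posSemidef hR₂.posSemidef
  have hRit := transpose_eq_of_posSemidef hRi
  have hSt := P.SK_transpose hQi hRi K
  -- `T1` and `T2` trade the trace against `D` for terms in `H` by pairing with the adjoint `Γ`.
  -- `T3` and `T4`, the gain equation and its transpose, cancel those terms. The rest is cyclicity
  -- of the trace.
  have T1 := congrArg (fun M => (Γ * M).trace) hD
  have T2 := congrArg (fun M => (M * D).trace) h.lyapunov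
  have T3 := congrArg (fun M => (M * (X * Hᵀ)).trace) h.gain
  have T4 := congrArg (fun M => (H * X * Mᵀ).trace) h.gain
  simp only [AKtilde, ← he, Matrix.transpose_add, Matrix.transpose_mul, Matrix.transpose_smul,
    Matrix.transpose_transpose, Matrix.transpose_zero, hXt, hΓt, hR₂t, hRit, hSt, Matrix.mul_add,
    Matrix.add_mul, Matrix.mul_assoc, Matrix.mul_zero, Matrix.zero_mul, zero_smul, add_zero,
    zero_add, Matrix.smul_mul, Matrix.mul_smul, smul_add, Matrix.trace_add, Matrix.trace_smul,
    Matrix.trace_zero, smul_eq_mul] at T1 T2 T3 T4 ⊢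
  have c {a b : ℕ} (M : Matrix (Fin a) (Fin b) ℝ) (N : Matrix (Fin b) (Fin a) ℝ) :
    (M * N).trace = (N * M).trace := Matrix.trace_mul_comm M N
  have c1 := c Hᵀ (P.R₂ * (K * X))
  have c2 := c (Kᵀ * P.R₂) (H * X)
  have c3 := c (Γ * P.B) (H * X)
  have c4 := c (Γ * D) (P.AK K)ᵀ
  have c5 := c (Γ * (X * Hᵀ)) P.Bᵀ
  have c6 := c (Γ * D) (P.SK K * X)
  have c7 := c (Γ * (X * Hᵀ)) (P.Ri * (K * X))
  have c8 := c (Γ * (X * (Kᵀ * P.Ri))) (H * X)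
  simp only [Matrix.mul_assoc] at c1 c2 c3 c4 c5 c6 c7 c8
  linear_combination T3 + T4 + T2 - T1 + c1 + c2 + c3 + c4 + c5 + e * c6 + e * c7 + e * c8

open scoped Matrix.Norms.Elementwise in
/-- A solution of the coupled optimality system is a critical point of `J_mix`. -/
theorem hasFDerivAt_Jmix (hR₂ : P.R₂.PosDef) (hQi : P.Qi.PosSemidef) (hRi : P.Ri.PosSemidef)
    {β : ℝ} {K : Matrix (Fin m) (Fin n) ℝ} {X Γ : Matrix (Fin n) (Fin n) ℝ}
    (h : P.SolvesOptimalitySystem β K X Γ) :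
    HasFDerivAt (P.Jmix β) (0 : Matrix (Fin m) (Fin n) ℝ →L[ℝ] ℝ) K := by
  set e := (β ^ 2)⁻¹ with he
  have hXt : Xᵀ = X := h.stabilizing.isSymm
  have hSt := P.SK_transpose hQi hRi K
  have hid := HasStrictDifferentialAt.id (K, X)
  have hF := P.hasStrictDifferentialAt_riccatiMap (HasStrictDifferentialAt.const e (K, X))
    hid.fst hid.snd
  -- The partial differential in `X` is `D ↦ Ã_K D + D Ã_Kᵀ`.
  have hinj : ∀ D : Matrix (Fin n) (Fin n) ℝ, P.B * (0 : Matrix (Fin m) (Fin n) ℝ) * X +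
      P.AK K * D + (D * (P.AK K)ᵀ + X * (P.B * (0 : Matrix (Fin m) (Fin n) ℝ))ᵀ) +
      ((0 : ℝ) • (X * P.SK K * X) + e • ((D * P.SK K + X * ((0 : Matrix (Fin m) (Fin n) ℝ)ᵀ * P.Ri *
        K + Kᵀ * P.Ri * (0 : Matrix (Fin m) (Fin n) ℝ))) * X + X * P.SK K * D)) + 0 = 0 →
      D = 0 := by
    intro D hD
    refine sylvester_eq_zero h.stabilizing.hurwitz h.stabilizing.hurwitz ?_
    rw [← hD]
    simp only [AKtilde, Matrix.transpose_add, Matrix.transpose_smul, Matrix.transpose_mul, hSt,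
      hXt, ← he]
    simp [add_mul, mul_add, ← mul_assoc]
    abel
  obtain ⟨φ, Dφ, hφ, hφK, hev, hlin⟩ := hF.exists_implicit h.stabilizing.riccati hinj
  have hev' : ∀ᶠ K' in 𝓝 K, P.riccatiMap e K' (φ K') = 0 := hev
  have hc := hφ.continuousAt
  have hcp : ContinuousAt (fun K' => (K', φ K')) K := continuousAt_id.prodMk hc
  have hH1 : ∀ᶠ K' in 𝓝 K, IsHurwitz (P.AKtilde β K' (φ K')) := by
    have hc1 : Continuous (fun p : Matrix (Fin m) (Fin n) ℝ × Matrix (Fin n) (Fin n) ℝ =>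
        P.AKtilde β p.1 p.2) := by
      unfold AKtilde AK SK; fun_prop
    refine (hc1.continuousAt.comp hcp).eventually (IsHurwitz.eventually ?_)
    rw [Function.comp_apply, hφK]
    exact h.stabilizing.hurwitz
  -- The implicit function is not known to be symmetric; this transposed stability condition makes
  -- it so.
  have hH2 : ∀ᶠ K' in 𝓝 K, IsHurwitz (P.AK K' + e • ((φ K')ᵀ * P.SK K')) := by
    have hc1 : Continuous (fun p : Matrix (Fin m) (Fin n) ℝ × Matrix (Fin n) (Fin n) ℝ =>
        P.AK p.1 + e • (p.2ᵀ * P.SK p.1)) := by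
      unfold AK SK; fun_prop
    refine (hc1.continuousAt.comp hcp).eventually (IsHurwitz.eventually ?_)
    rw [Function.comp_apply, hφK, hXt]
    exact h.stabilizing.hurwitz
  -- Uniqueness of stabilizing solutions identifies the chosen `X_K` with the smooth branch `φ`.
  have hXK : ∀ᶠ K' in 𝓝 K, P.XK β K' = φ K' := by
    filter_upwards [hev', hH1, hH2] with K' h1 h2 h3
    have hs : P.IsStabilizingSolution β K' (φ K') :=
      ⟨P.isSymm_of_riccatiMap_eq_zero hQi hRi h1 h3, h1, h2⟩
    have hex : ∃ X, P.IsStabilizingSolution β K' X := ⟨_, hs⟩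
    rw [XK, dif_pos hex]
    exact hex.choose_spec.unique hRi.1 hQi.1 hs
  have hJ := (((hasStrictDifferentialAt_quadratic P.Q₂ P.R₂ (HasStrictDifferentialAt.id K)).matrix_mul hφ)).matrix_trace
  obtain ⟨J', hJ', hJ''⟩ := hJ
  have hzero : J' = 0 := by
    ext H
    rw [hJ'', hφK]
    exact P.trace_differential_eq_zero hR₂ hQi hRi h H (Dφ H) (hlin H)
  rw [hzero] at hJ'
  refine hJ'.hasFDerivAt.congr_of_eventuallyEq ?_
  filter_upwards [hXK] with K' hK'
  rw [Jmix, hK']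

end Data

/-! ### Continuation from the LQR solution -/

namespace Data

variable {n m : ℕ} (P : Data n m)

open scoped Matrix.Norms.Elementwise in
/-- Continuation of the LQR solution: the equations of the coupled system, with `e` in place of
`β⁻²`, are solvable for all `e` near `0`, with stability and a uniform `H_∞` bound. -/
theorem exists_solution_near_zero (hQ₂ : P.Q₂.PosSemidef) (hR₂ : P.R₂.PosDef)
    (hstab : IsStabilizable P.A P.B) (hdet : IsDetectable (psdSqrt P.Q₂) P.A) :
    ∃ c : ℝ, 0 < c ∧ ∀ᶠ e : ℝ in 𝓝 0, ∃ (K : Matrix (Fin m) (Fin n) ℝ)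
      (Γ X : Matrix (Fin n) (Fin n) ℝ),
      P.R₂ * K + P.Bᵀ * Γ + e • (P.Ri * K * X * Γ) = 0 ∧
      (P.AK K + e • (X * P.SK K))ᵀ * Γ + Γ * (P.AK K + e • (X * P.SK K)) +
        (P.Q₂ + Kᵀ * P.R₂ * K) = 0 ∧
      P.riccatiMap e K X = 0 ∧ IsHurwitz (P.AK K) ∧ P.hinfNorm K ≤ ENNReal.ofReal c ∧
      IsHurwitz (P.AK K + e • (X * P.SK K)) ∧ IsHurwitz (P.AK K + e • (Xᵀ * P.SK K)) := by
  obtain ⟨K₀, Γ₀, hΓ₀, hK₀, hgain, hlyap⟩ := exists_lqr hQ₂ hR₂ hstab hdet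
  obtain ⟨X₀, hX₀⟩ := hK₀.transpose.exists_lyapunov P.W
  rw [Matrix.transpose_transpose] at hX₀
  have hA₀ : IsHurwitz (P.AK K₀) := hK₀
  have hlyap₀ : (P.AK K₀)ᵀ * Γ₀ + Γ₀ * P.AK K₀ + (P.Q₂ + K₀ᵀ * P.R₂ * K₀) = 0 := hlyap
  have hX₀' : P.AK K₀ * X₀ + X₀ * (P.AK K₀)ᵀ + P.W = 0 := hX₀
  obtain ⟨c, hc, hinf⟩ := P.eventually_hinfNorm_le hA₀
  refine ⟨c, hc, ?_⟩
  let u : ℝ × (Matrix (Fin m) (Fin n) ℝ × Matrix (Fin n) (Fin n) ℝ × Matrix (Fin n) (Fin n) ℝ) :=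
    (0, K₀, Γ₀, X₀)
  have hid := HasStrictDifferentialAt.id u
  have he := hid.fst
  have hk := hid.snd.fst
  have hg := hid.snd.snd.fst
  have hx := hid.snd.snd.snd
  have hA := (P.hasStrictDifferentialAt_AK hk).add
    (he.smul (hx.matrix_mul (P.hasStrictDifferentialAt_SK hk)))
  have hF1 := (((HasStrictDifferentialAt.const P.R₂ u).matrix_mul hk).add
    ((HasStrictDifferentialAt.const P.Bᵀ u).matrix_mul hg)).add
    (he.smul ((((HasStrictDifferentialAt.const P.Ri u).matrix_mul hk).matrix_mul hx).matrix_mul hg))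
  have hF2 := ((hA.matrix_transpose.matrix_mul hg).add (hg.matrix_mul hA)).add
    (hasStrictDifferentialAt_quadratic P.Q₂ P.R₂ hk)
  have hF3 := P.hasStrictDifferentialAt_riccatiMap he hk hx
  have hR₂t := transpose_eq_of_posSemidef hR₂.posSemidef
  have hΓt := transpose_eq_of_posSemidef hΓ₀
  obtain ⟨φ, Dφ, hφ, hφ0, hev, -⟩ := (hF1.prodMk (hF2.prodMk hF3)).exists_implicit
    (by simp [hgain, hlyap₀, hX₀', riccatiMap]) (by
    rintro ⟨k, g, x⟩ hD
    simp only [Prod.mk_eq_zero, u, zero_smul, add_zero, zero_add, Matrix.zero_mul] at hD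
    obtain ⟨h1, h2, h3⟩ := hD
    have hgt := congrArg Matrix.transpose hgain
    rw [Matrix.transpose_add, Matrix.transpose_mul, Matrix.transpose_mul, hR₂t, hΓt,
      Matrix.transpose_transpose, Matrix.transpose_zero] at hgt
    -- The linearization at `e = 0` is triangular: the gain equation cancels the `k` terms of the
    -- Lyapunov equation, leaving a homogeneous equation for `g`. Then `R₂ k = 0` gives `k = 0`, and
    -- `x` solves a homogeneous Lyapunov equation.
    have hg0 : g = 0 := by
      refine sylvester_eq_zero hA₀.transpose hA₀.transpose ?_
      have e1 : kᵀ * (P.R₂ * K₀ + P.Bᵀ * Γ₀) + (K₀ᵀ * P.R₂ + Γ₀ * P.B) * k = 0 := by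
        rw [hgain, hgt, Matrix.mul_zero, Matrix.zero_mul, add_zero]
      rw [Matrix.transpose_transpose, ← sub_zero (0 : Matrix (Fin n) (Fin n) ℝ)]
      nth_rewrite 1 [← h2]
      rw [← e1]
      simp only [Matrix.transpose_mul, Matrix.mul_add, Matrix.add_mul, ← Matrix.mul_assoc]
      abel
    have hk0 : k = 0 := by
      rw [hg0, Matrix.mul_zero, add_zero] at h1
      rw [← Matrix.one_mul k, ← Matrix.nonsing_inv_mul P.R₂
        ((Matrix.isUnit_iff_isUnit_det _).1 hR₂.isUnit), Matrix.mul_assoc, h1, Matrix.mul_zero]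
    have hx0 : x = 0 := by
      refine sylvester_eq_zero hA₀ hA₀ ?_
      simpa [hk0] using h3
    rw [hg0, hk0, hx0]
    rfl)
  have hcφ : ContinuousAt (fun e => (e, φ e)) 0 := continuousAt_id.prodMk hφ.continuousAt
  have hH1 : ∀ᶠ e in 𝓝 0,
      IsHurwitz (P.AK (φ e).1 + e • ((φ e).2.2 * P.SK (φ e).1)) := by
    have hc1 : Continuous (fun p : ℝ × (Matrix (Fin m) (Fin n) ℝ × Matrix (Fin n) (Fin n) ℝ ×
        Matrix (Fin n) (Fin n) ℝ) => P.AK p.2.1 + p.1 • (p.2.2.2 * P.SK p.2.1)) := by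
      unfold AK SK; fun_prop
    refine (hc1.continuousAt.comp hcφ).eventually (IsHurwitz.eventually ?_)
    simpa [hφ0] using hA₀
  have hH2 : ∀ᶠ e in 𝓝 0,
      IsHurwitz (P.AK (φ e).1 + e • ((φ e).2.2ᵀ * P.SK (φ e).1)) := by
    have hc1 : Continuous (fun p : ℝ × (Matrix (Fin m) (Fin n) ℝ × Matrix (Fin n) (Fin n) ℝ ×
        Matrix (Fin n) (Fin n) ℝ) => P.AK p.2.1 + p.1 • (p.2.2.2ᵀ * P.SK p.2.1)) := by
      unfold AK SK; fun_prop
    refine (hc1.continuousAt.comp hcφ).eventually (IsHurwitz.eventually ?_)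
    simpa [hφ0] using hA₀
  have hinf' : ∀ᶠ e in 𝓝 0,
      IsHurwitz (P.AK (φ e).1) ∧ P.hinfNorm (φ e).1 ≤ ENNReal.ofReal c := by
    have ht := (continuous_fst.tendsto (φ 0)).comp hφ.continuousAt
    rw [hφ0] at ht
    exact ht.eventually hinf
  filter_upwards [hev, hH1, hH2, hinf'] with e h0 h1 h2 h3
  obtain ⟨h4, h5⟩ := Prod.mk_eq_zero.1 h0
  obtain ⟨h5, h6⟩ := Prod.mk_eq_zero.1 h5
  exact ⟨_, _, _, h4, h5, h6, h3.1, h3.2, h1, h2⟩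

/-! ### Definiteness of the solution and invertibility in the gain formula -/

theorem SK_posSemidef (hQi : P.Qi.PosSemidef) (hRi : P.Ri.PosSemidef)
    (K : Matrix (Fin m) (Fin n) ℝ) : (P.SK K).PosSemidef :=
  hQi.add (posSemidef_transpose_mul_mul hRi K)

/-- The stabilizing solution at a stabilizing gain is positive semidefinite. -/
theorem IsStabilizingSolution.posSemidef {P : Data n m} (hQi : P.Qi.PosSemidef)
    (hRi : P.Ri.PosSemidef) {β : ℝ} {K : Matrix (Fin m) (Fin n) ℝ} {X : Matrix (Fin n) (Fin n) ℝ}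
    (h : P.IsStabilizingSolution β K X) (hK : IsHurwitz (P.AK K)) : X.PosSemidef := by
  have h1 := posSemidef_transpose_mul_mul (P.SK_posSemidef hQi hRi K) X
  rw [h.isSymm.eq] at h1
  refine hK.transpose.posSemidef_of_lyapunov
    ((h1.smul (by positivity : 0 ≤ (β ^ 2)⁻¹)).add P.W_posSemidef) ?_
  rw [Matrix.transpose_transpose, ← add_assoc]
  exact h.riccati

/-- A positive semidefinite stabilizing solution is positive definite when `W` is. -/
theorem IsStabilizingSolution.posDef {P : Data n m} {β : ℝ} {K : Matrix (Fin m) (Fin n) ℝ}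
    {X : Matrix (Fin n) (Fin n) ℝ} (h : P.IsStabilizingSolution β K X) (hX : X.PosSemidef)
    (hW : P.W.PosDef) : X.PosDef := by
  rw [hX.posDef_iff_det_ne_zero]
  intro h0
  obtain ⟨v, hv0, hv⟩ := Matrix.exists_mulVec_eq_zero_iff.2 h0
  have hv' : v ᵥ* X = 0 := by rw [← Matrix.mulVec_transpose, h.isSymm.eq, hv]
  have h1 := congrArg (fun M => v ⬝ᵥ (M *ᵥ v)) h.riccati
  simp only [Matrix.add_mulVec, dotProduct_add, Matrix.smul_mulVec, ← Matrix.mulVec_mulVec, hv,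
    Matrix.dotProduct_mulVec v X, hv', Matrix.mulVec_zero, dotProduct_zero, zero_dotProduct,
    smul_zero, zero_add, Matrix.zero_mulVec] at h1
  have h2 := hW.dotProduct_mulVec_pos hv0
  rw [star_trivial, h1] at h2
  exact h2.false

end Data

/-- `1 + c X Γ` is invertible for positive semidefinite `X`, `Γ` and `c ≥ 0`. -/
theorem isUnit_one_add_smul_mul {n : ℕ} {X Γ : Matrix (Fin n) (Fin n) ℝ} (hX : X.PosSemidef)
    (hΓ : Γ.PosSemidef) {c : ℝ} (hc : 0 ≤ c) : IsUnit (1 + c • (X * Γ)) := by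
  rw [Matrix.isUnit_iff_isUnit_det, isUnit_iff_ne_zero]
  intro h0
  obtain ⟨v, hv0, hv⟩ := Matrix.exists_mulVec_eq_zero_iff.2 h0
  rw [Matrix.add_mulVec, Matrix.one_mulVec, Matrix.smul_mulVec, ← Matrix.mulVec_mulVec] at hv
  -- Pairing with `Γ v` yields `vᵀ Γ v + c (Γ v)ᵀ X (Γ v) = 0`, a sum of nonnegative terms. Hence `Γ
  -- v = 0`, and then `v = 0`.
  have h1 := congrArg (fun w => w ⬝ᵥ (Γ *ᵥ v)) hv
  simp only [add_dotProduct, smul_dotProduct, zero_dotProduct, smul_eq_mul] at h1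
  have h2 := hΓ.dotProduct_mulVec_nonneg v
  have h3 := hX.dotProduct_mulVec_nonneg (Γ *ᵥ v)
  rw [star_trivial] at h2 h3
  rw [dotProduct_comm (X *ᵥ _)] at h1
  have h4 : v ⬝ᵥ (Γ *ᵥ v) = 0 := le_antisymm (by nlinarith [mul_nonneg hc h3]) h2
  have h5 := (hΓ.dotProduct_mulVec_zero_iff v).1 (by rwa [star_trivial])
  rw [h5, Matrix.mulVec_zero, smul_zero, add_zero] at hv
  exact hv0 hv

end MixedControl

/-! ### Assembly of the main theorem -/

theorem mainTheorem9 {n m : ℕ} (P : MixedControl.Data n m)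
    (hQ₂ : P.Q₂.PosSemidef) (hR₂ : P.R₂.PosDef)
    (hQi : P.Qi.PosSemidef) (hRi : P.Ri.PosSemidef)
    (hstab : MixedControl.IsStabilizable P.A P.B)
    (hdet : MixedControl.IsDetectable (MixedControl.psdSqrt P.Q₂) P.A) :
    ∃ βbar : ℝ, 0 < βbar ∧ ∀ β : ℝ, βbar < β →
      ∃ (K : Matrix (Fin m) (Fin n) ℝ) (X Γ : Matrix (Fin n) (Fin n) ℝ),
        P.IsStationaryPoint β K ∧
        P.SolvesOptimalitySystem β K X Γ ∧
        (P.W.PosDef → X.PosDef) ∧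
        (∀ α : ℝ, 0 ≤ α → P.Ri = α ^ 2 • P.R₂ →
          IsUnit (1 + ((β ^ 2)⁻¹ * α ^ 2) • (X * Γ)) ∧
          K = -(P.R₂⁻¹ * P.Bᵀ * Γ * (1 + ((β ^ 2)⁻¹ * α ^ 2) • (X * Γ))⁻¹)) := by
  obtain ⟨c, hc, hev⟩ := P.exists_solution_near_zero hQ₂ hR₂ hstab hdet
  have hlim : Filter.Tendsto (fun β : ℝ => (β ^ 2)⁻¹) Filter.atTop (nhds 0) :=
    (Filter.tendsto_pow_atTop two_ne_zero).inv_tendsto_atTop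
  obtain ⟨b, hb⟩ := Filter.eventually_atTop.1 (hlim.eventually hev)
  -- Beyond `b` the parameter `β⁻²` lies in the continuation range; beyond `c` the `H_∞` bound
  -- becomes strict feasibility.
  refine ⟨max b c, lt_max_of_lt_right hc, fun β hβ => ?_⟩
  obtain ⟨K, Γ, X, h1, h2, h3, hK, hinf, hH1, hH2⟩ := hb β ((le_max_left b c).trans hβ.le)
  have hcβ : c < β := (le_max_right b c).trans_lt hβ
  have hs : P.IsStabilizingSolution β K X :=
    ⟨P.isSymm_of_riccatiMap_eq_zero hQi hRi h3 hH2, h3, hH1⟩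
  have hX := hs.posSemidef hQi hRi hK
  have hΓ : Γ.PosSemidef := hH1.posSemidef_of_lyapunov
    (hQ₂.add (MixedControl.posSemidef_transpose_mul_mul hR₂.posSemidef K)) h2
  have hsys : P.SolvesOptimalitySystem β K X Γ := ⟨h1, hs, by rw [add_assoc]; exact h2, hX, hΓ⟩
  refine ⟨K, X, Γ, ⟨⟨hK, hinf.trans_lt ?_⟩, P.hasFDerivAt_Jmix hR₂ hQi hRi hsys⟩, hsys,
    hs.posDef hX, fun α _ hα => ?_⟩
  · exact (ENNReal.ofReal_lt_ofReal_iff (hc.trans hcβ)).2 hcβ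
  · have hu := MixedControl.isUnit_one_add_smul_mul hX hΓ
      (by positivity : 0 ≤ (β ^ 2)⁻¹ * α ^ 2)
    refine ⟨hu, ?_⟩
    have huR := (Matrix.isUnit_iff_isUnit_det _).1 hR₂.isUnit
    set T := 1 + ((β ^ 2)⁻¹ * α ^ 2) • (X * Γ) with hT
    -- When `R_∞ = α² R₂`, the factor `R₂ K` can be pulled out of the gain equation on the left.
    have e1 : P.R₂ * (K * T) = -(P.Bᵀ * Γ) := by
      rw [← sub_eq_zero, sub_neg_eq_add, ← h1, hα, hT]
      simp only [Matrix.mul_add, Matrix.mul_one, Matrix.mul_smul, Matrix.smul_mul, smul_smul,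
        Matrix.mul_assoc]
      abel
    have e2 : K * T = -(P.R₂⁻¹ * P.Bᵀ * Γ) := by
      rw [← Matrix.one_mul (K * T), ← Matrix.nonsing_inv_mul _ huR, Matrix.mul_assoc, e1,
        Matrix.mul_neg, Matrix.mul_assoc]
    rw [← Matrix.neg_mul, ← e2, Matrix.mul_assoc,
      Matrix.mul_nonsing_inv _ ((Matrix.isUnit_iff_isUnit_det _).1 hu), Matrix.mul_one]
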